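/- A set system $(S,F)$ with $S$ finite and $F\subseteq 2^S$ is a matroid if (M1) $\emptyset\in F$; (M2) $Y\subseteq X\in F$ implies $Y\in F$; (M3) whenever $X,Y\in F$ and $|X|>|Y|$ there is $x\in X\setminus Y$ with $Y\cup\{x\}\in F$. It is a greedoid if (M1) and (M3) hold. A family $(S_h,F_h)_{h\in H}$, whose indices $h$ are coded by words over a finite alphabet, is given by a uniform polynomial-time oracle if a single algorithm, given $h\in H$ and $X\subseteq S_h$, decides whether $X\in F_h$ in time polynomial in $|S_h|$. A parameterized problem $L$ reduces to a parameterized problem $L'$ by a standard parameterized $m$-reduction if there are functions $f,g:\mathbb N\to\mathbb N$, a constant $c$ and a map $(x,k)\mapsto x'$ such that $(x,k)\in L$ if and only if $(x',f(k))\in L'$, and the pair $(x',f(k))$ is computable from $(x,k)$ in time $g(k)(|x|+1)^c$. Weighted circuit satisfiability asks, given a boolean circuit $e$ and a parameter $k$, whether $e$ has a satisfying truth assignment with exactly $k$ variables set to true. $W[P]$ is the class of the parameterized problems that reduce to weighted circuit satisfiability, and a parameterized problem is $W[P]$-hard if every problem in $W[P]$ reduces to it. Theorem. There are a matroid family $(S_h,F_h)_{h\in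 H}$ and a greedoid family $(S_h,G_h)_{h\in H}$ over the same domains, both given by uniform polynomial-time oracles and with $S_h$ computable in time polynomial in $|h|$ (so that $|S_h|$ is polynomial in $|h|$), such that the parameterized intersection problem "given an index $h\in H$ and a parameter $k$, is there a set $X\in F_h\cap G_h$ with $|X|=k$?" is $W[P]$-hard. Moreover, weighted circuit satisfiability reduces to this problem by a standard parameterized $m$-reduction with $f(k)=k+1$. -/

import Mathlib

namespace MGI

/-! ### Matroids and greedoids as set systems -/

/-- A collection `F` of subsets of a finite domain is (the collection of independent sets of) a
matroid: (M1) it contains the empty set, (M2) it is closed under subsets and (M3) it has the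
exchange property. -/
structure IsMatroid {α : Type} [DecidableEq α] (F : Set (Finset α)) : Prop where
  empty_mem : ∅ ∈ F
  subset_mem : ∀ ⦃X Y : Finset α⦄, X ∈ F → Y ⊆ X → Y ∈ F
  exchange : ∀ ⦃X Y : Finset α⦄, X ∈ F → Y ∈ F → Y.card < X.card →
    ∃ x ∈ X \ Y, insert x Y ∈ F

/-- A collection `F` of subsets of a finite domain is (the collection of feasible sets of) a
greedoid: (M1) it contains the empty set and (M3) it has the exchange property. -/
structure IsGreedoid {α : Type} [DecidableEq α] (F : Set (Finset α)) : Prop where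
  empty_mem : ∅ ∈ F
  exchange : ∀ ⦃X Y : Finset α⦄, X ∈ F → Y ∈ F → Y.card < X.card →
    ∃ x ∈ X \ Y, insert x Y ∈ F

/-! ### Time-bounded computation

The machine model is Mathlib's `Turing.FinTM2`: a deterministic (multi-stack, that is, multi-tape)
Turing machine. -/

/-- `ComputableWithin ea eb f t`: some Turing machine, started on the code `ea a`, halts with
output the code `eb (f a)` after at most `t a` steps, for every `a`. -/
def ComputableWithin {α β Γ₀ Γ₁ : Type} (ea : α → List Γ₀) (eb : β → List Γ₁)
    (f : α → β) (t : α → ℕ) : Prop :=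
  ∃ M : Turing.TM2ComputableAux Γ₀ Γ₁, ∀ a : α,
    Nonempty (Turing.TM2OutputsInTime M.tm ((ea a).map M.inputAlphabet.symm)
      (some ((eb (f a)).map M.outputAlphabet.symm)) (t a))

/-! ### Parameterized problems and reductions -/

/-- A parameterized decision problem: a type of instances, coded as words over a finite alphabet,
and the set of those pairs of an instance and a parameter for which the answer is yes.
A language `L ⊆ Σ* × ℕ` is the case where the instances are the words over `Σ`. -/
structure ParamProblem where
  Inst : Type
  Γ : Type
  [finΓ : Fintype Γ]
  enc : Computability.Encoding Inst Γ
  yes : Inst → ℕ → Prop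

/-- The code of a pair (instance, parameter); the two parts are told apart by `Sum.inl` and
`Sum.inr`, and the parameter is written in unary. -/
def ParamProblem.encPair (P : ParamProblem) : P.Inst × ℕ → List (P.Γ ⊕ Bool) :=
  (Computability.encodingProd P.enc Computability.unaryEncodingNat).encode

/-- `P` reduces to `Q` by a standard parameterized `m`-reduction that maps the parameter `k` to
`f k`: there is a map `(x, k) ↦ (r x k, f k)` that preserves and reflects the answer yes and that a
Turing machine computes in time `g k * (|x| + 1) ^ c`, with a function `g` and a constant `c`. -/
def ReducesVia (P Q : ParamProblem) (f : ℕ → ℕ) : Prop :=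
  ∃ (r : P.Inst → ℕ → Q.Inst) (g : ℕ → ℕ) (c : ℕ),
    ComputableWithin P.encPair Q.encPair (fun p => (r p.1 p.2, f p.2))
      (fun p => g p.2 * ((P.enc.encode p.1).length + 1) ^ c) ∧
    ∀ x k, P.yes x k ↔ Q.yes (r x k) (f k)

/-- `P` reduces to `Q` by a standard parameterized `m`-reduction. -/
def Reduces (P Q : ParamProblem) : Prop :=
  ∃ f : ℕ → ℕ, ReducesVia P Q f

/-! ### Boolean circuits -/

/-- A gate of a boolean circuit. The arguments are the numbers of the wires that enter the gate;
conjunctions and disjunctions have arbitrary fan-in. -/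
inductive Gate
  | and (args : List ℕ)
  | or (args : List ℕ)
  | not (arg : ℕ)

/-- The wires that enter a gate. -/
def Gate.args : Gate → List ℕ
  | .and is => is
  | .or is => is
  | .not i => [i]

/-- The value of a gate when the wires carry the values `v`. -/
def Gate.eval (v : List Bool) : Gate → Bool
  | .and is => is.all fun i => v.getD i false
  | .or is => is.any fun i => v.getD i false
  | .not i => !(v.getD i false)

/-- A boolean circuit: an acyclic network of gates, listed in a topological order. Wires
`0, …, n - 1` are the input variables, wire `n + j` is the output of the `j`-th gate, the arguments
of a gate are earlier wires, and `out` is the output wire of the circuit. -/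
@[ext] structure Circuit where
  n : ℕ
  gates : List Gate
  out : ℕ
  args_lt : ∀ (j : ℕ) (hj : j < gates.length), ∀ i ∈ gates[j].args, i < n + j
  out_lt : out < n + gates.length

/-- The values of all wires of a circuit under a truth assignment. -/
def Circuit.wires (C : Circuit) (a : Fin C.n → Bool) : List Bool :=
  C.gates.foldl (fun v g => v ++ [g.eval v]) (List.ofFn a)

/-- The value of a circuit under a truth assignment. -/
def Circuit.eval (C : Circuit) (a : Fin C.n → Bool) : Bool :=
  (C.wires a).getD C.out false

/-- The alphabet in which circuits are written. -/
inductive CSym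
  | tick
  | mark
  | and
  | or
  | not
  deriving DecidableEq

instance : Fintype CSym where
  elems := {CSym.tick, CSym.mark, CSym.and, CSym.or, CSym.not}
  complete s := by cases s <;> decide

/-- A wire number is written in unary, with an end marker. -/
def codeNat (i : ℕ) : List CSym := List.replicate i CSym.tick ++ [CSym.mark]

/-- A gate is written as its type, followed by its arguments. -/
def Gate.code : Gate → List CSym
  | .and is => CSym.and :: is.flatMap codeNat
  | .or is => CSym.or :: is.flatMap codeNat
  | .not i => CSym.not :: codeNat i

/-- A circuit is written as its number of variables, its output wire and the list of its gates. -/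
def Circuit.code (C : Circuit) : List CSym :=
  codeNat C.n ++ codeNat C.out ++ C.gates.flatMap Gate.code

theorem codeNat_append_inj : ∀ {i j : ℕ} {u v : List CSym},
    codeNat i ++ u = codeNat j ++ v → i = j ∧ u = v
  | 0, 0, u, v, h => by simpa [codeNat] using h
  | 0, j + 1, u, v, h => by simp [codeNat, List.replicate_succ] at h
  | i + 1, 0, u, v, h => by simp [codeNat, List.replicate_succ] at h
  | i + 1, j + 1, u, v, h => by
    have h' : codeNat i ++ u = codeNat j ++ v := by
      simpa [codeNat, List.replicate_succ] using h
    have := codeNat_append_inj h'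
    exact ⟨by omega, this.2⟩

theorem codeNat_eq_cons (i : ℕ) : ∃ s l, codeNat i = s :: l ∧ (s = CSym.tick ∨ s = CSym.mark) := by
  cases i with
  | zero => exact ⟨_, _, rfl, Or.inr rfl⟩
  | succ i => exact ⟨_, _, rfl, Or.inl rfl⟩

/-- The list does not begin with a symbol of a number. -/
def NoNat (l : List CSym) : Prop := ∀ s ∈ l.head?, s ≠ CSym.tick ∧ s ≠ CSym.mark

theorem NoNat.ne_codeNat {u v : List CSym} (hu : NoNat u) (i : ℕ) : u ≠ codeNat i ++ v := by
  rintro rfl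
  obtain ⟨s, l, h, hs⟩ := codeNat_eq_cons i
  have := hu s (by simp [h])
  rcases hs with rfl | rfl <;> simp_all

theorem codeArgs_append_inj : ∀ {is js : List ℕ} {u v : List CSym}, NoNat u → NoNat v →
    is.flatMap codeNat ++ u = js.flatMap codeNat ++ v → is = js ∧ u = v
  | [], [], u, v, _, _, h => by simpa using h
  | [], j :: js, u, v, hu, _, h => by
    refine (hu.ne_codeNat j (v := js.flatMap codeNat ++ v) ?_).elim
    simpa using h
  | i :: is, [], u, v, _, hv, h => by
    refine (hv.ne_codeNat i (v := is.flatMap codeNat ++ u) ?_).elim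
    simpa using h.symm
  | i :: is, j :: js, u, v, hu, hv, h => by
    simp only [List.flatMap_cons, List.append_assoc] at h
    obtain ⟨rfl, h₁⟩ := codeNat_append_inj h
    obtain ⟨rfl, h₂⟩ := codeArgs_append_inj hu hv h₁
    exact ⟨rfl, h₂⟩

theorem noNat_codeGates (gs : List Gate) : NoNat (gs.flatMap Gate.code) := by
  cases gs with
  | nil => intro s hs; simp at hs
  | cons g gs => cases g <;> simp [NoNat, Gate.code]

theorem codeGates_inj : ∀ {gs hs : List Gate},
    gs.flatMap Gate.code = hs.flatMap Gate.code → gs = hs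
  | [], [], _ => rfl
  | [], h :: hs, e => by cases h <;> simp [Gate.code] at e
  | g :: gs, [], e => by cases g <;> simp [Gate.code] at e
  | g :: gs, h :: hs, e => by
    cases g <;> cases h <;>
      simp only [List.flatMap_cons, Gate.code, List.cons_append, List.cons.injEq, reduceCtorEq,
        true_and, false_and] at e
    · obtain ⟨rfl, e₁⟩ := codeArgs_append_inj (noNat_codeGates gs) (noNat_codeGates hs) e
      rw [codeGates_inj e₁]
    · obtain ⟨rfl, e₁⟩ := codeArgs_append_inj (noNat_codeGates gs) (noNat_codeGates hs) e
      rw [codeGates_inj e₁]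
    · obtain ⟨rfl, e₁⟩ := codeNat_append_inj e
      rw [codeGates_inj e₁]

theorem Circuit.code_injective : Function.Injective Circuit.code := by
  intro C D h
  simp only [Circuit.code, List.append_assoc] at h
  obtain ⟨h1, h⟩ := codeNat_append_inj h
  obtain ⟨h2, h⟩ := codeNat_append_inj h
  exact Circuit.ext h1 (codeGates_inj h) h2

open Classical in
/-- The encoding of circuits by words. -/
noncomputable def circuitEncoding : Computability.Encoding Circuit CSym where
  encode := Circuit.code
  decode w := if h : ∃ C : Circuit, C.code = w then some h.choose else none
  decode_encode C := by
    have h : ∃ D : Circuit, D.code = C.code := ⟨C, rfl⟩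
    rw [dif_pos h, Circuit.code_injective h.choose_spec]

/-! ### Weighted circuit satisfiability and the class W[P] -/

/-- Parameterized weighted circuit satisfiability: does the circuit have a satisfying truth
assignment with exactly `k` variables set to true? -/
noncomputable def weightedCircuitSat : ParamProblem where
  Inst := Circuit
  Γ := CSym
  enc := circuitEncoding
  yes C k := ∃ a : Fin C.n → Bool,
    C.eval a = true ∧ (Finset.univ.filter fun i => a i = true).card = k

/-- The class W[P]: the parameterized problems that reduce to weighted circuit satisfiability. -/
def InWP (P : ParamProblem) : Prop := Reduces P weightedCircuitSat

/-- A parameterized problem is W[P]-hard if every problem in W[P] reduces to it. -/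
def WPHard (Q : ParamProblem) : Prop := ∀ P : ParamProblem, InWP P → Reduces P Q

/-! ### Families of set systems and their intersection problem -/

/-- A family of finite domains, one for each index in an index set `H`, whose elements are coded as
words over a finite alphabet. The domain `S_h` of the index `h` is `Fin (size h)`, so that
`|S_h| = size h`. -/
structure DomainFamily where
  H : Type
  Γ : Type
  [finΓ : Fintype Γ]
  enc : Computability.Encoding H Γ
  size : H → ℕ

/-- The domain `S_h` can be written down in time polynomial in `|h|`: the map `h ↦ |S_h|`, with
unary output, is computable in polynomial time. In particular, `|S_h|` is polynomial in `|h|`. -/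
def DomainFamily.IsPolyTime (D : DomainFamily) : Prop :=
  Nonempty (Turing.TM2ComputableInPolyTime D.enc.encode Computability.unaryEncodeNat D.size)

/-- A collection of subsets of `S_h` for each index `h`. -/
abbrev DomainFamily.SetSystem (D : DomainFamily) : Type :=
  ∀ h : D.H, Set (Finset (Fin (D.size h)))

/-- The code of a query `(h, X)` with `X ⊆ S_h`: the code of `h`, followed by the `|S_h|` bits of
the indicator function of `X`. -/
def DomainFamily.encQuery (D : DomainFamily) (q : Σ h : D.H, Finset (Fin (D.size h))) :
    List (D.Γ ⊕ Bool) :=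
  (D.enc.encode q.1).map Sum.inl ++ (List.ofFn fun i => decide (i ∈ q.2)).map Sum.inr

open Classical in
/-- The family `(S_h, F_h)` is given by a uniform polynomial-time oracle: a single algorithm, given
`h` and `X ⊆ S_h`, answers whether `X ∈ F_h` in time polynomial in `|S_h|`. -/
def HasUniformPolyTimeOracle (D : DomainFamily) (F : D.SetSystem) : Prop :=
  ∃ p : Polynomial ℕ,
    ComputableWithin D.encQuery Computability.encodeBool (fun q => decide (q.2 ∈ F q.1))
      (fun q => p.eval (D.size q.1))

/-- The parameterized intersection problem for two families over the same domains: given an index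
`h` and a parameter `k`, is there a set `X ∈ F_h ∩ G_h` with `|X| = k`? -/
def intersectionProblem (D : DomainFamily) (F G : D.SetSystem) : ParamProblem where
  Inst := D.H
  Γ := D.Γ
  finΓ := D.finΓ
  enc := D.enc
  yes h k := ∃ X : Finset (Fin (D.size h)), X ∈ F h ∩ G h ∧ X.card = k

end MGI

/-!
The index of both families is a pair `(C, k)` of a circuit with `n` variables and a weight, and the
domain consists of the `n` variables, a top element and loops, which only pad the domain to the
length of the code of the index. The matroid `weightMatroid` is the direct sum of the uniform
matroid of rank `k` on the variables and the free matroid on the top element. In the greedoid `satGreedoid`,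
a set without the top element is feasible if it contains at most `k + 1` variables, and a set with
the top element is feasible if it contains exactly `k` variables and these satisfy `C`. A common
feasible set of size `k + 1` must contain the top element, because the matroid admits at most `k`
variables, and is therefore a satisfying assignment of weight `k`
(`weightedCircuitSat_yes_iff`). The greedoid has the exchange property (`isGreedoid_satGreedoid`)
because all sets of at most `k + 1` variables are feasible: a feasible set of size at most `k` lacks
the top element and can be augmented by any further variable, and if the larger set offers no such
variable, then the smaller one consists of the `k` variables of a satisfying assignment and can be
augmented by the top element. The reduction maps `(C, k)` to the index `(C, k)` and the parameter `k + 1`,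
and hardness follows as reductions compose (`ReducesVia.trans`).

All time bounds refer to machines of Mathlib's model `Turing.FinTM2`. They are obtained from a small
calculus of program fragments, `Prog`, with a judgement `Prog.Runs` that gives the returned value,
the resulting stacks and a bound on the number of steps, and with the rules `Prog.Runs.bind`,
`Prog.Runs.iter_stop` and `Prog.Runs.iter_next` for composition and iteration. A program becomes a
machine by `ComputableWithin.of_prog`, and a machine becomes a program by `Prog.runs_ofMachine`, so
that machines can be composed (`ComputableWithin.comp`).

Both oracles run the same program, `oracleProg`. It counts the variables of the query against the
unary weight, tests for the top element and for loops, and evaluates the circuit on a tape that holds the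
values of the wires found so far (`runs_evalGates`). Each symbol of the code of the circuit causes
boundedly many passes over this tape, which makes the running time quadratic in the size of the
domain. Membership in either family is a Boolean function of the data so obtained
(`hasUniformPolyTimeOracle_of_iff`).
-/

namespace MGI

open Turing

/-! ### Structured stack programs -/

/-- The machine with statements `M` goes from `c` to `c'` in at most `n` steps. -/
def Reach {K Λ σ : Type} [DecidableEq K] {Γ : K → Type} (M : Λ → TM2.Stmt Γ Λ σ) (n : ℕ)
    (c c' : TM2.Cfg Γ Λ σ) : Prop :=
  Nonempty (StateTransition.EvalsToInTime (TM2.step M) c (some c') n)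

section Reach

variable {K Λ σ : Type} [DecidableEq K] {Γ : K → Type} {M : Λ → TM2.Stmt Γ Λ σ}
  {c c₁ c₂ : TM2.Cfg Γ Λ σ} {m n : ℕ}

theorem Reach.trans (h₁ : Reach M m c c₁) (h₂ : Reach M n c₁ c₂) : Reach M (m + n) c c₂ := by
  obtain ⟨h₁⟩ := h₁
  obtain ⟨h₂⟩ := h₂
  exact ⟨add_comm n m ▸ h₁.trans _ _ _ _ _ _ h₂⟩

theorem Reach.mono (h : Reach M m c c₁) (hmn : m ≤ n) : Reach M n c c₁ := by
  obtain ⟨h⟩ := h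
  exact ⟨⟨h.toEvalsTo, h.steps_le_m.trans hmn⟩⟩

theorem Reach.step {l : Λ} {v : σ} {S : ∀ k, List (Γ k)}
    (h : TM2.stepAux (M l) v S = c) : Reach M 1 ⟨some l, v, S⟩ c := by
  subst h
  exact ⟨⟨⟨1, rfl⟩, le_rfl⟩⟩

end Reach

/-- A program fragment for a machine with stacks `Γ` and internal states `σ` that returns a value of
type `α`. It consists of a finite set of labels, one of them the entry, and of the statements at
these labels. The statements are parametric in the embedding of the labels into those of the
surrounding machine and in the continuation, which is the label to go to for each returned value.
Data that control the execution are thus kept in the labels and not in the internal state. -/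
structure Prog {K : Type} (Γ : K → Type) (σ α : Type) where
  Lab : Type
  [finLab : Finite Lab]
  entry : Lab
  code : ∀ {Λ : Type}, (Lab → Λ) → (α → Λ) → Lab → TM2.Stmt Γ Λ σ

attribute [instance] Prog.finLab

namespace Prog

variable {K σ α β : Type} {Γ : K → Type}

/-- Return a value. -/
def ret (a : α) : Prog Γ σ α where
  Lab := Unit
  entry := ()
  code _ next _ := .goto fun _ => next a

/-- Push a symbol. -/
def push (k : K) (x : Γ k) : Prog Γ σ Unit where
  Lab := Unit
  entry := ()
  code _ next _ := .push k (fun _ => x) (.goto fun _ => next ())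

/-- Pop a symbol, keep it in the internal state by means of `store`, and return what `read` finds
there. -/
def popWith (k : K) (store : σ → Option (Γ k) → σ) (read : σ → α) : Prog Γ σ α where
  Lab := Unit
  entry := ()
  code _ next _ := .pop k store (.goto fun v => next (read v))

/-- Sequential composition. -/
def bind [Finite α] (p : Prog Γ σ α) (f : α → Prog Γ σ β) : Prog Γ σ β where
  Lab := p.Lab ⊕ Σ a, (f a).Lab
  entry := .inl p.entry
  code emb next
    | .inl l => p.code (fun l => emb (.inl l)) (fun a => emb (.inr ⟨a, (f a).entry⟩)) l
    | .inr ⟨a, l⟩ => (f a).code (fun l => emb (.inr ⟨a, l⟩)) next l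

/-- Sequential composition with a fragment that does not depend on a value. -/
def seq (p : Prog Γ σ Unit) (q : Prog Γ σ β) : Prog Γ σ β := p.bind fun _ => q

/-- Iteration: run `body a`; continue with `a'` if it returns `Sum.inl a'`, and stop with result `b`
if it returns `Sum.inr b`. -/
def iter [Finite α] (body : α → Prog Γ σ (α ⊕ β)) (a : α) : Prog Γ σ β where
  Lab := Σ a, (body a).Lab
  entry := ⟨a, (body a).entry⟩
  code emb next l := (body l.1).code (fun l' => emb ⟨l.1, l'⟩)
    (Sum.elim (fun a => emb ⟨a, (body a).entry⟩) next) l.2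

/-- `p.Runs S a S' n`: started with stacks `S`, the fragment `p` returns `a` with stacks `S'` within
`n` steps, in every machine that contains `p` and from every internal state. -/
structure Runs [DecidableEq K] (p : Prog Γ σ α) (S : ∀ k, List (Γ k)) (a : α)
    (S' : ∀ k, List (Γ k)) (n : ℕ) : Prop where
  reach : ∀ {Λ : Type} (M : Λ → TM2.Stmt Γ Λ σ) (emb : p.Lab → Λ) (next : α → Λ),
    (∀ l, M (emb l) = p.code emb next l) → ∀ v, ∃ v',
      Reach M n ⟨some (emb p.entry), v, S⟩ ⟨some (next a), v', S'⟩

section Runs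

variable [DecidableEq K] {S S₁ S₂ : ∀ k, List (Γ k)} {m n : ℕ}

theorem Runs.mono {p : Prog Γ σ α} {a : α} (h : p.Runs S a S₁ m) (hmn : m ≤ n) :
    p.Runs S a S₁ n where
  reach M emb next hM v :=
    let ⟨v', h'⟩ := h.reach M emb next hM v
    ⟨v', h'.mono hmn⟩

theorem runs_ret (a : α) : (ret a : Prog Γ σ α).Runs S a S 1 where
  reach _ _ _ hM v := ⟨v, Reach.step (by rw [hM]; rfl)⟩

theorem runs_push (k : K) (x : Γ k) :
    (push k x : Prog Γ σ Unit).Runs S () (Function.update S k (x :: S k)) 1 where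
  reach _ _ _ hM v := ⟨v, Reach.step (by rw [hM]; rfl)⟩

theorem runs_popWith {k : K} {store : σ → Option (Γ k) → σ} {read : σ → α}
    {r : Option (Γ k) → α} (h : ∀ v o, read (store v o) = r o) :
    (popWith k store read).Runs S (r (S k).head?) (Function.update S k (S k).tail) 1 where
  reach _ _ _ hM v := ⟨store v (S k).head?, Reach.step (by rw [hM, ← h v]; rfl)⟩

theorem Runs.bind [Finite α] {p : Prog Γ σ α} {f : α → Prog Γ σ β} {a : α} {b : β}
    (h₁ : p.Runs S a S₁ m) (h₂ : (f a).Runs S₁ b S₂ n) : (p.bind f).Runs S b S₂ (m + n) where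
  reach M emb next hM v :=
    let ⟨v₁, r₁⟩ := h₁.reach M (fun l => emb (.inl l)) _ (fun l => hM (.inl l)) v
    let ⟨v₂, r₂⟩ := h₂.reach M (fun l => emb (.inr ⟨a, l⟩)) next (fun l => hM (.inr ⟨a, l⟩)) v₁
    ⟨v₂, r₁.trans r₂⟩

theorem Runs.seq {p : Prog Γ σ Unit} {q : Prog Γ σ β} {b : β} (h₁ : p.Runs S () S₁ m)
    (h₂ : q.Runs S₁ b S₂ n) : (p.seq q).Runs S b S₂ (m + n) := h₁.bind h₂

theorem Runs.iter_stop [Finite α] {body : α → Prog Γ σ (α ⊕ β)} {a : α} {b : β}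
    (h : (body a).Runs S (.inr b) S₁ n) : (iter body a).Runs S b S₁ n where
  reach M emb _ hM v := h.reach M (fun l => emb ⟨a, l⟩) _ (fun l => hM ⟨a, l⟩) v

theorem Runs.iter_next [Finite α] {body : α → Prog Γ σ (α ⊕ β)} {a a' : α} {b : β}
    (h₁ : (body a).Runs S (.inl a') S₁ m) (h₂ : (iter body a').Runs S₁ b S₂ n) :
    (iter body a).Runs S b S₂ (m + n) where
  reach M emb next hM v :=
    let ⟨v₁, r₁⟩ := h₁.reach M (fun l => emb ⟨a, l⟩) _ (fun l => hM ⟨a, l⟩) v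
    let ⟨v₂, r₂⟩ := h₂.reach M emb next hM v₁
    ⟨v₂, r₁.trans r₂⟩

end Runs

end Prog

/-! ### From programs to machines -/

/-- The stacks that are all empty except for the contents `l` of the stack `k`. -/
def single {K : Type} [DecidableEq K] {Γ : K → Type} (k : K) (l : List (Γ k)) (k' : K) :
    List (Γ k') :=
  Function.update (fun _ => []) k l k'

theorem initList_eq (tm : FinTM2) (s : List (tm.Γ tm.k₀)) :
    initList tm s = ⟨some tm.main, tm.initialState, single tm.k₀ s⟩ := by
  unfold initList
  congr 1
  funext k
  by_cases h : k = tm.k₀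
  · subst h; simp [single]
  · simp [single, h]

theorem haltList_eq (tm : FinTM2) (s : List (tm.Γ tm.k₁)) :
    haltList tm s = ⟨none, tm.initialState, single tm.k₁ s⟩ := by
  unfold haltList
  congr 1
  funext k
  by_cases h : k = tm.k₁
  · subst h; simp [single]
  · simp [single, h]

theorem ComputableWithin.mono {α β Γ₀ Γ₁ : Type} {ea : α → List Γ₀} {eb : β → List Γ₁}
    {f : α → β} {t t' : α → ℕ} (h : ComputableWithin ea eb f t) (ht : ∀ a, t a ≤ t' a) :
    ComputableWithin ea eb f t' := by
  obtain ⟨M, hM⟩ := h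
  refine ⟨M, fun a => ?_⟩
  obtain ⟨h⟩ := hM a
  exact ⟨⟨h.toEvalsTo, h.steps_le_m.trans (ht a)⟩⟩

/-- A program that transforms the input stack into the output stack yields a machine. -/
theorem ComputableWithin.of_prog {K σ : Type} [DecidableEq K] [Finite K] {Γ : K → Type}
    [Finite σ] (v₀ : σ) {k₀ k₁ : K} {Γ₀ Γ₁ : Type} [Finite Γ₀] (e₀ : Γ k₀ ≃ Γ₀)
    (e₁ : Γ k₁ ≃ Γ₁) (p : Prog Γ σ Unit) {α β : Type} {ea : α → List Γ₀} {eb : β → List Γ₁}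
    {f : α → β} {t : α → ℕ}
    (h : ∀ a, p.Runs (single k₀ ((ea a).map e₀.symm)) () (single k₁ ((eb (f a)).map e₁.symm))
      (t a)) : ComputableWithin ea eb f (fun a => t a + 1) := by
  have := Finite.of_equiv _ e₀.symm
  have := Fintype.ofFinite K
  have := Fintype.ofFinite σ
  have := Fintype.ofFinite (Γ k₀)
  have := Fintype.ofFinite (Option p.Lab)
  let M : Option p.Lab → TM2.Stmt Γ (Option p.Lab) σ := fun
    | none => .load (fun _ => v₀) .halt
    | some l => p.code some (fun _ => none) l
  let tm : FinTM2 :=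
    { K := K, k₀ := k₀, k₁ := k₁, Γ := Γ, Λ := Option p.Lab, main := some p.entry, σ := σ,
      initialState := v₀, m := M }
  refine ⟨⟨tm, e₀, e₁⟩, fun a => ?_⟩
  obtain ⟨v', r⟩ := (h a).reach M some (fun _ => none) (fun _ => rfl) v₀
  obtain ⟨r⟩ := r.trans (Reach.step (M := M) (l := none) rfl)
  unfold TM2OutputsInTime
  rw [initList_eq, Option.map_some, haltList_eq]
  exact ⟨r⟩

/-! ### Machines as programs -/

section Lift

variable {K K' Λ σ σ' : Type} [DecidableEq K] [DecidableEq K'] {Γ' : K' → Type} {i : K → K'}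

/-- The statement `q` of a machine, transported to a machine with further stacks and with a larger
internal state, of which `get` and `set` access the relevant part. The labels are mapped by `g`, and
instead of halting the machine goes to the label `exit`. -/
def liftStmt (i : K → K') (get : σ' → σ) (set : σ' → σ → σ') {Λ' : Type} (g : Λ → Λ')
    (exit : Λ') : TM2.Stmt (fun k => Γ' (i k)) Λ σ → TM2.Stmt Γ' Λ' σ'
  | .push k f q => .push (i k) (fun v => f (get v)) (liftStmt i get set g exit q)
  | .peek k f q => .peek (i k) (fun v o => set v (f (get v) o)) (liftStmt i get set g exit q)
  | .pop k f q => .pop (i k) (fun v o => set v (f (get v) o)) (liftStmt i get set g exit q)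
  | .load f q => .load (fun v => set v (f (get v))) (liftStmt i get set g exit q)
  | .branch f q₁ q₂ => .branch (fun v => f (get v)) (liftStmt i get set g exit q₁)
      (liftStmt i get set g exit q₂)
  | .goto f => .goto fun v => g (f (get v))
  | .halt => .goto fun _ => exit

theorem update_comp_inj (hi : Function.Injective i) (S : ∀ k, List (Γ' k)) (k : K)
    (l : List (Γ' (i k))) :
    (fun j => Function.update S (i k) l (i j)) = Function.update (fun j => S (i j)) k l := by
  funext j
  by_cases h : j = k
  · subst h; simp
  · simp [h, hi.ne h]

theorem stepAux_liftStmt (hi : Function.Injective i) {get : σ' → σ} {set : σ' → σ → σ'}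
    (hgs : ∀ v x, get (set v x) = x) {Λ' : Type} (g : Λ → Λ') (exit : Λ')
    (q : TM2.Stmt (fun k => Γ' (i k)) Λ σ) (v : σ') (S : ∀ k, List (Γ' k)) :
    ∃ v' S', TM2.stepAux (liftStmt i get set g exit q) v S =
        ⟨some ((TM2.stepAux q (get v) fun k => S (i k)).l.elim exit g), v', S'⟩ ∧
      get v' = (TM2.stepAux q (get v) fun k => S (i k)).var ∧
      (fun k => S' (i k)) = (TM2.stepAux q (get v) fun k => S (i k)).stk ∧
      ∀ k', k' ∉ Set.range i → S' k' = S k' := by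
  induction q generalizing v S with
  | push k f q ih =>
    obtain ⟨v', S', h₁, h₂, h₃, h₄⟩ := ih v (Function.update S (i k) (f (get v) :: S (i k)))
    rw [update_comp_inj hi] at h₁ h₂ h₃
    refine ⟨v', S', h₁, h₂, h₃, fun k' hk' => ?_⟩
    rw [h₄ k' hk', Function.update_of_ne]
    rintro rfl
    exact hk' ⟨k, rfl⟩
  | peek k f q ih =>
    obtain ⟨v', S', h₁, h₂, h₃, h₄⟩ := ih (set v (f (get v) (S (i k)).head?)) S
    rw [hgs] at h₁ h₂ h₃
    exact ⟨v', S', h₁, h₂, h₃, h₄⟩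
  | pop k f q ih =>
    obtain ⟨v', S', h₁, h₂, h₃, h₄⟩ := ih (set v (f (get v) (S (i k)).head?))
      (Function.update S (i k) (S (i k)).tail)
    rw [update_comp_inj hi, hgs] at h₁ h₂ h₃
    refine ⟨v', S', h₁, h₂, h₃, fun k' hk' => ?_⟩
    rw [h₄ k' hk', Function.update_of_ne]
    rintro rfl
    exact hk' ⟨k, rfl⟩
  | load f q ih =>
    obtain ⟨v', S', h₁, h₂, h₃, h₄⟩ := ih (set v (f (get v))) S
    rw [hgs] at h₁ h₂ h₃
    exact ⟨v', S', h₁, h₂, h₃, h₄⟩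
  | branch f q₁ q₂ ih₁ ih₂ =>
    simp only [liftStmt, TM2.stepAux]
    cases f (get v)
    · exact ih₂ v S
    · exact ih₁ v S
  | goto f => exact ⟨v, S, rfl, rfl, rfl, fun _ _ => rfl⟩
  | halt => exact ⟨v, S, rfl, rfl, rfl, fun _ _ => rfl⟩

/-- A machine as a program fragment that begins with setting the internal state. -/
def Prog.ofMachine [Finite Λ] (i : K → K') (get : σ' → σ) (set : σ' → σ → σ')
    (m : Λ → TM2.Stmt (fun k => Γ' (i k)) Λ σ) (main : Λ) (v₀ : σ) : Prog Γ' σ' Unit where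
  Lab := Option Λ
  entry := none
  code emb next
    | none => .load (fun v => set v v₀) (.goto fun _ => emb (some main))
    | some l => liftStmt i get set (fun l => emb (some l)) (next ()) (m l)

theorem iterate_bind_none {α : Type} (f : α → Option α) (n : ℕ) :
    (flip Option.bind f)^[n] none = none := by
  induction n with
  | zero => rfl
  | succ n ih => exact ih

theorem Prog.runs_ofMachine [Finite Λ] (hi : Function.Injective i) {get : σ' → σ}
    {set : σ' → σ → σ'} (hgs : ∀ v x, get (set v x) = x)
    {m : Λ → TM2.Stmt (fun k => Γ' (i k)) Λ σ} {main : Λ} {v₀ v₁ : σ} {S S₁ : ∀ k, List (Γ' k)}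
    {n : ℕ} (h : Reach m n ⟨some main, v₀, fun k => S (i k)⟩ ⟨none, v₁, fun k => S₁ (i k)⟩)
    (hS : ∀ k', k' ∉ Set.range i → S₁ k' = S k') :
    (ofMachine i get set m main v₀).Runs S () S₁ (n + 1) := by
  refine ⟨fun {Λ'} M emb next hM v => ?_⟩
  have key : ∀ (n : ℕ) (l : Λ) (v : σ') (S : ∀ k, List (Γ' k)),
      (flip Option.bind (TM2.step m))^[n] (some ⟨some l, get v, fun k => S (i k)⟩) =
        some ⟨none, v₁, fun k => S₁ (i k)⟩ →
      (∀ k', k' ∉ Set.range i → S₁ k' = S k') →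
      ∃ v', Reach M n ⟨some (emb (some l)), v, S⟩ ⟨some (next ()), v', S₁⟩ := by
    intro n
    induction n with
    | zero => intro l v S h; simp at h
    | succ n ih =>
      intro l v S h hS
      obtain ⟨v', S', h₁, h₂, h₃, h₄⟩ :=
        stepAux_liftStmt hi hgs (fun l => emb (some l)) (next ()) (m l) v S
      have hstep := Reach.step (M := M) ((congrArg (TM2.stepAux · v S) (hM (some l))).trans h₁)
      rw [Function.iterate_succ_apply] at h
      change (flip Option.bind (TM2.step m))^[n]
        (some (TM2.stepAux (m l) (get v) fun k => S (i k))) = _ at h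
      generalize TM2.stepAux (m l) (get v) (fun k => S (i k)) = c at h h₂ h₃ hstep
      obtain ⟨l', w, T⟩ := c
      dsimp only at h₂ h₃
      subst h₂ h₃
      cases l' with
      | some l' =>
        obtain ⟨v'', r⟩ := ih l' v' S' h fun k' hk' => (hS k' hk').trans (h₄ k' hk').symm
        exact ⟨v'', (hstep.trans r).mono (by omega)⟩
      | none =>
        have e : S' = S₁ := by
          have e₁ : ∀ k, S' (i k) = S₁ (i k) := by
            cases n with
            | zero =>
              simp only [Function.iterate_zero, id_eq, Option.some.injEq, TM2.Cfg.mk.injEq,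
                true_and] at h
              exact fun k => congrFun h.2 k
            | succ n =>
              rw [Function.iterate_succ_apply] at h
              have := (iterate_bind_none (TM2.step m) n).symm.trans h
              simp at this
          funext k'
          by_cases hk' : k' ∈ Set.range i
          · obtain ⟨k, rfl⟩ := hk'
            exact e₁ k
          · rw [h₄ k' hk', hS k' hk']
        subst e
        exact ⟨v', hstep.mono (by omega)⟩
  obtain ⟨⟨⟨s, h⟩, hs⟩⟩ := h
  rw [← hgs v v₀] at h
  obtain ⟨v', r⟩ := key s main (set v v₀) S h hS
  exact ⟨v', ((Reach.step (by rw [hM]; rfl)).trans r).mono (by dsimp only at hs; omega)⟩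

end Lift

/-! ### Composition of computations -/

/-- The number of push operations in a statement. -/
def numPush {K Λ σ : Type} {Γ : K → Type} : TM2.Stmt Γ Λ σ → ℕ
  | .push _ _ q => numPush q + 1
  | .peek _ _ q => numPush q
  | .pop _ _ q => numPush q
  | .load _ q => numPush q
  | .branch _ q₁ q₂ => numPush q₁ + numPush q₂
  | .goto _ => 0
  | .halt => 0

section Length

variable {K Λ σ : Type} [DecidableEq K] {Γ : K → Type}

theorem length_stepAux_le (q : TM2.Stmt Γ Λ σ) (v : σ) (S : ∀ k, List (Γ k)) (k : K) :
    ((TM2.stepAux q v S).stk k).length ≤ (S k).length + numPush q := by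
  induction q generalizing v S with
  | push k' f q ih =>
    refine (ih _ _).trans ?_
    by_cases h : k = k'
    · subst h; simp only [Function.update_self, List.length_cons, numPush]; omega
    · simp only [Function.update_of_ne h, numPush]; omega
  | peek k' f q ih => exact ih _ _
  | pop k' f q ih =>
    refine (ih _ _).trans ?_
    by_cases h : k = k'
    · subst h; simp [numPush]
    · simp [numPush, h]
  | load f q ih => exact ih _ _
  | branch f q₁ q₂ ih₁ ih₂ =>
    simp only [TM2.stepAux, numPush]
    cases f v
    · exact (ih₂ _ _).trans (by omega)
    · exact (ih₁ _ _).trans (by omega)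
  | goto f => exact le_rfl
  | halt => exact le_rfl

theorem Reach.length_le {M : Λ → TM2.Stmt Γ Λ σ} {B : ℕ} (hB : ∀ l, numPush (M l) ≤ B) {n : ℕ}
    {c c' : TM2.Cfg Γ Λ σ} (h : Reach M n c c') (k : K) :
    (c'.stk k).length ≤ (c.stk k).length + B * n := by
  have key : ∀ (n : ℕ) (c : TM2.Cfg Γ Λ σ),
      (flip Option.bind (TM2.step M))^[n] (some c) = some c' →
      (c'.stk k).length ≤ (c.stk k).length + B * n := by
    intro n
    induction n with
    | zero =>
      intro c h
      obtain rfl : c = c' := by simpa using h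
      simp
    | succ n ih =>
      rintro ⟨l, v, S⟩ h
      rw [Function.iterate_succ_apply] at h
      cases l with
      | none =>
        have := (iterate_bind_none (TM2.step M) n).symm.trans h
        simp at this
      | some l =>
        have h₁ := ih _ h
        have h₂ := length_stepAux_le (M l) v S k
        have h₃ := hB l
        rw [Nat.mul_succ]
        dsimp only at h₁ ⊢
        omega
  obtain ⟨⟨⟨s, h⟩, hs⟩⟩ := h
  exact (key s c h).trans (Nat.add_le_add_left (Nat.mul_le_mul_left _ hs) _)

end Length

theorem single_length_le {K : Type} [DecidableEq K] {Γ : K → Type} (k k' : K) (l : List (Γ k)) :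
    (single k l k').length ≤ l.length := by
  by_cases h : k' = k
  · subst h; simp [single]
  · simp [single, h]

@[simp]
theorem single_self {K : Type} [DecidableEq K] {Γ : K → Type} (k : K) (l : List (Γ k)) :
    single k l k = l := by simp [single]

theorem single_of_ne {K : Type} [DecidableEq K] {Γ : K → Type} {k k' : K} (l : List (Γ k))
    (h : k' ≠ k) : single k l k' = [] := by simp [single, h]

/-- The stacks of the composite of two machines: the stacks of both and an auxiliary one. -/
def CompΓ (M N : FinTM2) : (M.K ⊕ N.K) ⊕ Unit → Type
  | .inl (.inl k) => M.Γ k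
  | .inl (.inr k) => N.Γ k
  | .inr () => N.Γ N.k₀

/-- Move the contents of the stack `k` to the stack `k'`, in reverse order. A symbol is represented
by an element of the finite type `B` in transit. -/
def Prog.moveWith {K σ B : Type} {Γ : K → Type} [Finite B] (k k' : K)
    (store : σ → Option (Γ k) → σ) (read : σ → Option B) (g : B → Γ k') : Prog Γ σ Unit :=
  Prog.iter (fun _ : Unit => (Prog.popWith k store read).bind fun
    | none => Prog.ret (.inr ())
    | some b => (Prog.push k' (g b)).bind fun _ => Prog.ret (.inl ())) ()

theorem Prog.runs_moveWith {K σ B : Type} [DecidableEq K] {Γ : K → Type} [Finite B] {k k' : K}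
    (hk : k ≠ k') {store : σ → Option (Γ k) → σ} {read : σ → Option B} {g : B → Γ k'}
    {r : Γ k → B} (h : ∀ v o, read (store v o) = o.map r) (S : ∀ k, List (Γ k)) :
    (moveWith k k' store read g).Runs S ()
      (Function.update (Function.update S k []) k' (((S k).map fun x => g (r x)).reverse ++ S k'))
      (3 * (S k).length + 2) := by
  generalize hl : S k = l
  induction l generalizing S with
  | nil =>
    refine (Runs.iter_stop (Runs.bind (m := 1) (n := 1) (runs_popWith h) ?_)).mono le_rfl
    rw [hl]
    have e : Function.update (Function.update S k []) k' ((([] : List (Γ k)).map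
        fun x => g (r x)).reverse ++ S k') = Function.update S k [] := by
      funext j
      by_cases h₁ : j = k'
      · subst h₁; simp [hk.symm]
      · simp [h₁]
    rw [e]
    exact runs_ret _
  | cons x l ih =>
    refine (Runs.iter_next (S₁ := Function.update (Function.update S k l) k' (g (r x) :: S k'))
      (a' := ()) (m := 3) (n := 3 * l.length + 2)
      (Runs.bind (m := 1) (n := 2) (runs_popWith h) ?_) ?_).mono ?_
    · rw [hl]
      refine Runs.bind (m := 1) (n := 1) (runs_push _ _) ?_
      simpa [hk.symm] using runs_ret _
    · have ih' := ih (Function.update (Function.update S k l) k' (g (r x) :: S k')) (by simp [hk])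
      have e : Function.update (Function.update S k []) k' (((x :: l).map
          fun x => g (r x)).reverse ++ S k') = Function.update (Function.update (Function.update
          (Function.update S k l) k' (g (r x) :: S k')) k []) k'
          ((l.map fun x => g (r x)).reverse ++
            Function.update (Function.update S k l) k' (g (r x) :: S k') k') := by
        funext j
        by_cases h₁ : j = k'
        · subst h₁; simp
        · by_cases h₂ : j = k
          · subst h₂; simp [hk]
          · simp [h₁, h₂]
      rw [e]
      exact ih'
    · simp only [List.length_cons]; omega

theorem Prog.runs_moveWith_single {K σ B : Type} [DecidableEq K] {Γ : K → Type} [Finite B]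
    {k k' : K} (hk : k ≠ k') {store : σ → Option (Γ k) → σ} {read : σ → Option B} {g : B → Γ k'}
    {r : Γ k → B} (h : ∀ v o, read (store v o) = o.map r) {l : List (Γ k)} {l' : List (Γ k')}
    (hl : (l.map fun x => g (r x)).reverse = l') {n : ℕ} (hn : l.length = n) :
    (moveWith k k' store read g).Runs (single k l) () (single k' l') (3 * n + 2) := by
  subst hl hn
  have := runs_moveWith hk (g := g) h (single k l)
  rw [single_self, single_of_ne _ hk.symm, List.append_nil] at this
  convert this using 1
  funext j
  by_cases h₁ : j = k'
  · subst h₁; simp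
  · by_cases h₂ : j = k
    · subst h₂; simp [single_of_ne _ h₁, h₁]
    · simp [single_of_ne _ h₁, single_of_ne _ h₂, h₁, h₂]

theorem single_comp_inj {K K' : Type} [DecidableEq K] [DecidableEq K'] {Γ' : K' → Type}
    {i : K → K'} (hi : Function.Injective i) (k : K) (l : List (Γ' (i k))) :
    (fun j => single (i k) l (i j)) = single (Γ := fun j => Γ' (i j)) k l :=
  update_comp_inj hi (fun _ => []) k l

theorem reach_of_outputs {tm : FinTM2} {s : List (tm.Γ tm.k₀)} {s' : List (tm.Γ tm.k₁)} {n : ℕ}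
    (h : TM2OutputsInTime tm s (some s') n) :
    Reach tm.m n ⟨some tm.main, tm.initialState, single tm.k₀ s⟩
      ⟨none, tm.initialState, single tm.k₁ s'⟩ := by
  rw [← initList_eq, ← haltList_eq]
  exact ⟨h⟩

/-- The output is not longer than the input plus a multiple of the running time. -/
theorem ComputableWithin.length_le {α β Γ₀ Γ₁ : Type} {ea : α → List Γ₀} {eb : β → List Γ₁}
    {f : α → β} {t : α → ℕ} (hf : ComputableWithin ea eb f t) :
    ∃ B, ∀ a, (eb (f a)).length ≤ (ea a).length + B * t a := by
  obtain ⟨⟨M, i₀, i₁⟩, hM⟩ := hf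
  dsimp only at hM
  obtain ⟨B, hB⟩ : ∃ B, ∀ l, numPush (M.m l) ≤ B :=
    have := M.ΛFin
    ⟨Finset.univ.sup fun l => numPush (M.m l), fun l =>
      Finset.le_sup (f := fun l => numPush (M.m l)) (Finset.mem_univ l)⟩
  refine ⟨B, fun a => ?_⟩
  obtain ⟨r₁⟩ := hM a
  have h := Reach.length_le hB (reach_of_outputs r₁) M.k₁
  have h₁ := single_length_le M.k₀ M.k₁ ((ea a).map i₀.symm)
  simp only [single_self, List.length_map] at h h₁
  omega

/-- Machines can be run one after the other. The composite has the stacks of both and one more,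
through which the output of the first becomes, in the right order, the input of the second. -/
theorem ComputableWithin.comp {α β γ Γ₀ Γ₁ Γ₂ : Type} {ea : α → List Γ₀} {eb : β → List Γ₁}
    {ec : γ → List Γ₂} {f : α → β} {g : β → γ} {t : α → ℕ} {t' : β → ℕ}
    (hf : ComputableWithin ea eb f t) (hg : ComputableWithin eb ec g t') :
    ∃ B, ComputableWithin ea ec (fun a => g (f a))
      fun a => B * ((ea a).length + t a + 1) + t' (f a) := by
  obtain ⟨B, hB⟩ := hf.length_le
  obtain ⟨⟨M, i₀, i₁⟩, hM⟩ := hf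
  obtain ⟨⟨N, j₀, j₁⟩, hN⟩ := hg
  dsimp only at hM hN
  have := M.ΛFin
  have := N.ΛFin
  have := M.σFin
  have := N.σFin
  have := M.kFin
  have := N.kFin
  have := M.Γk₀Fin
  have := N.Γk₀Fin
  have : Finite Γ₀ := Finite.of_equiv _ i₀
  let e : M.Γ M.k₁ ≃ N.Γ N.k₀ := i₁.trans j₀.symm
  let σ := M.σ × N.σ × Option (N.Γ N.k₀)
  let p₁ : Prog (CompΓ M N) σ Unit := Prog.ofMachine (fun k => .inl (.inl k)) Prod.fst
    (fun v x => (x, v.2)) M.m M.main M.initialState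
  let p₂ : Prog (CompΓ M N) σ Unit := Prog.moveWith (.inl (.inl M.k₁)) (.inr ())
    (fun v o => (v.1, v.2.1, o.map e)) (fun v => v.2.2) id
  let p₃ : Prog (CompΓ M N) σ Unit := Prog.moveWith (.inr ()) (.inl (.inr N.k₀))
    (fun v o => (v.1, v.2.1, o)) (fun v => v.2.2) id
  let p₄ : Prog (CompΓ M N) σ Unit := Prog.ofMachine (fun k => .inl (.inr k)) (fun v => v.2.1)
    (fun v x => (v.1, x, v.2.2)) N.m N.main N.initialState
  refine ⟨6 * B + 7, ComputableWithin.mono (ComputableWithin.of_prog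
    ((M.initialState, N.initialState, none) : σ)
    (k₀ := .inl (.inl M.k₀)) (k₁ := .inl (.inr N.k₁)) i₀ j₁
    (p₁.bind fun _ => p₂.bind fun _ => p₃.bind fun _ => p₄)
    (t := fun a => t a + 1 + (3 * (eb (f a)).length + 2 +
      (3 * (eb (f a)).length + 2 + (t' (f a) + 1)))) fun a => ?_) fun a => ?_⟩
  · obtain ⟨r₁⟩ := hM a
    obtain ⟨r₂⟩ := hN (f a)
    have inj₁ : Function.Injective (fun k : M.K => (.inl (.inl k) : (M.K ⊕ N.K) ⊕ Unit)) :=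
      fun _ _ h => by simpa using h
    have inj₂ : Function.Injective (fun k : N.K => (.inl (.inr k) : (M.K ⊕ N.K) ⊕ Unit)) :=
      fun _ _ h => by simpa using h
    have q₁ : p₁.Runs (single (Γ := CompΓ M N) (.inl (.inl M.k₀)) ((ea a).map i₀.symm)) ()
        (single (Γ := CompΓ M N) (.inl (.inl M.k₁)) ((eb (f a)).map i₁.symm)) (t a + 1) := by
      refine Prog.runs_ofMachine (Γ' := CompΓ M N) inj₁ (fun _ _ => rfl)
        (v₁ := M.initialState) ?_ ?_
      · rw [single_comp_inj (Γ' := CompΓ M N) inj₁, single_comp_inj (Γ' := CompΓ M N) inj₁]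
        exact reach_of_outputs r₁
      · intro k' hk'
        rw [single_of_ne, single_of_ne] <;> rintro rfl <;> exact hk' ⟨_, rfl⟩
    have q₄ : p₄.Runs (single (Γ := CompΓ M N) (.inl (.inr N.k₀)) ((eb (f a)).map j₀.symm)) ()
        (single (Γ := CompΓ M N) (.inl (.inr N.k₁)) ((ec (g (f a))).map j₁.symm))
        (t' (f a) + 1) := by
      refine Prog.runs_ofMachine (Γ' := CompΓ M N) inj₂ (fun _ _ => rfl)
        (v₁ := N.initialState) ?_ ?_
      · rw [single_comp_inj (Γ' := CompΓ M N) inj₂, single_comp_inj (Γ' := CompΓ M N) inj₂]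
        exact reach_of_outputs r₂
      · intro k' hk'
        rw [single_of_ne, single_of_ne] <;> rintro rfl <;> exact hk' ⟨_, rfl⟩
    have l₁ : (((eb (f a)).map i₁.symm).map fun x => e x).reverse =
        ((eb (f a)).map j₀.symm).reverse := by simp [e, Function.comp_def]
    have l₂ : ((((eb (f a)).map j₀.symm).reverse).map fun x => x).reverse =
        (eb (f a)).map j₀.symm := by simp
    have q₂ : p₂.Runs (single (Γ := CompΓ M N) (.inl (.inl M.k₁)) ((eb (f a)).map i₁.symm)) ()
        (single (Γ := CompΓ M N) (.inr ()) ((eb (f a)).map j₀.symm).reverse)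
        (3 * (eb (f a)).length + 2) :=
      Prog.runs_moveWith_single (Γ := CompΓ M N) (σ := σ) (k := .inl (.inl M.k₁)) (k' := .inr ())
        (by simp) (store := fun v o => (v.1, v.2.1, o.map e)) (read := fun v => v.2.2) (g := id)
        (r := e) (fun _ _ => rfl) l₁ (List.length_map _)
    have q₃ : p₃.Runs (single (Γ := CompΓ M N) (.inr ()) ((eb (f a)).map j₀.symm).reverse) ()
        (single (Γ := CompΓ M N) (.inl (.inr N.k₀)) ((eb (f a)).map j₀.symm))
        (3 * (eb (f a)).length + 2) :=
      Prog.runs_moveWith_single (Γ := CompΓ M N) (σ := σ) (k := .inr ()) (k' := .inl (.inr N.k₀))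
        (by simp) (store := fun v o => (v.1, v.2.1, o)) (read := fun v => v.2.2) (g := id)
        (r := id) (fun _ o => (congrFun Option.map_id o).symm) l₂
        ((List.length_reverse).trans (List.length_map _))
    exact q₁.bind (q₂.bind (q₃.bind q₄))
  · have h := hB a
    generalize (ea a).length = x at h ⊢
    generalize (eb (f a)).length = y at h ⊢
    nlinarith [Nat.zero_le (B * x), Nat.zero_le (B * t a)]

/-! ### Composition of reductions -/

theorem unaryEncodeNat_eq_replicate (k : ℕ) :
    Computability.unaryEncodeNat k = List.replicate k true := by
  induction k with
  | zero => rfl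
  | succ k ih => simp [Computability.unaryEncodeNat, ih, List.replicate_succ]

theorem ParamProblem.encPair_eq (P : ParamProblem) (x : P.Inst) (k : ℕ) :
    P.encPair (x, k) = (P.enc.encode x).map .inl ++ List.replicate k (.inr true) := by
  simp [encPair, Computability.encodingProd, Computability.unaryEncodingNat,
    unaryEncodeNat_eq_replicate]

theorem ParamProblem.length_encPair (P : ParamProblem) (x : P.Inst) (k : ℕ) :
    (P.encPair (x, k)).length = (P.enc.encode x).length + k := by
  simp [P.encPair_eq]

/-- Reductions compose: the intermediate instance has length at most `|x| + A * g k * |x| ^ c`, so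
the time of the second reduction is again a function of `k` times a power of `|x| + 1`. -/
theorem ReducesVia.trans {P Q R : ParamProblem} {f f' : ℕ → ℕ} (h : ReducesVia P Q f)
    (h' : ReducesVia Q R f') : ReducesVia P R (fun k => f' (f k)) := by
  obtain ⟨r, g, c, hr, hyes⟩ := h
  obtain ⟨r', g', c', hr', hyes'⟩ := h'
  obtain ⟨A, hA⟩ := hr.length_le
  obtain ⟨B, hB⟩ := hr.comp hr'
  refine ⟨fun x k => r' (r x k) (f k),
    fun k => B * (1 + k + g k) + g' (f k) * (1 + k + A * g k) ^ c', (c + 1) * (c' + 1),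
    hB.mono ?_, fun x k => (hyes x k).trans (hyes' _ _)⟩
  rintro ⟨x, k⟩
  have hlen := hA (x, k)
  rw [Q.length_encPair, P.length_encPair] at hlen
  dsimp only at hlen ⊢
  rw [P.length_encPair]
  generalize hX : (P.enc.encode x).length + 1 = X at hlen ⊢
  generalize (Q.enc.encode (r x k)).length = Y at hlen ⊢
  have hX1 : 1 ≤ X := by omega
  have e₁ : X ≤ X ^ (c + 1) := Nat.le_self_pow (by omega) X
  have e₂ : X ^ c ≤ X ^ (c + 1) := Nat.pow_le_pow_right hX1 (by omega)
  have e₃ : X ^ (c + 1) ≤ X ^ ((c + 1) * (c' + 1)) :=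
    Nat.pow_le_pow_right hX1 (Nat.le_mul_of_pos_right _ (by omega))
  have e₄ : (X ^ (c + 1)) ^ c' ≤ X ^ ((c + 1) * (c' + 1)) := by
    rw [← pow_mul]
    exact Nat.pow_le_pow_right hX1 (Nat.mul_le_mul_left _ (by omega))
  have e₅ : 1 ≤ X ^ (c + 1) := hX1.trans e₁
  have h₁ : Y + 1 ≤ (1 + k + A * g k) * X ^ (c + 1) := by
    calc Y + 1 ≤ X + k * 1 + A * g k * X ^ c := by rw [mul_assoc]; omega
      _ ≤ X ^ (c + 1) + k * X ^ (c + 1) + A * g k * X ^ (c + 1) := by gcongr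
      _ = _ := by ring
  have h₂ : (P.enc.encode x).length + k + g k * X ^ c + 1 ≤ (1 + k + g k) * X ^ (c + 1) := by
    calc _ = X + k * 1 + g k * X ^ c := by omega
      _ ≤ X ^ (c + 1) + k * X ^ (c + 1) + g k * X ^ (c + 1) := by gcongr
      _ = _ := by ring
  calc _ ≤ B * ((1 + k + g k) * X ^ (c + 1)) +
        g' (f k) * ((1 + k + A * g k) * X ^ (c + 1)) ^ c' := by gcongr
    _ = B * (1 + k + g k) * X ^ (c + 1) +
        g' (f k) * (1 + k + A * g k) ^ c' * (X ^ (c + 1)) ^ c' := by rw [mul_pow]; ring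
    _ ≤ B * (1 + k + g k) * X ^ ((c + 1) * (c' + 1)) +
        g' (f k) * (1 + k + A * g k) ^ c' * X ^ ((c + 1) * (c' + 1)) := by gcongr
    _ = _ := by ring

/-! ### The matroid and the greedoid of a circuit and a weight -/

/-- The domains of the two families. An index consists of a circuit and a weight `k`, and its domain
has as many elements as its code has symbols: the variables `0, …, n - 1` of the circuit, a top
element `n`, and further elements, loops of both set systems, that make the size of the domain
comparable to the length of the code. -/
noncomputable def circuitDomain : DomainFamily where
  H := Circuit × ℕ
  Γ := CSym ⊕ Bool
  enc := Computability.encodingProd circuitEncoding Computability.unaryEncodingNat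
  size h := (weightedCircuitSat.encPair h).length

theorem size_eq (h : Circuit × ℕ) : circuitDomain.size h = h.1.code.length + h.2 :=
  weightedCircuitSat.length_encPair h.1 h.2

theorem n_lt_size (h : Circuit × ℕ) : h.1.n < circuitDomain.size h := by
  rw [size_eq]
  simp [Circuit.code, codeNat]
  omega

/-- A variable as an element of the domain. -/
noncomputable def varElt (h : Circuit × ℕ) (j : Fin h.1.n) : Fin (circuitDomain.size h) :=
  ⟨j, j.2.trans (n_lt_size h)⟩

/-- The top element of the domain. -/
noncomputable def topElt (h : Circuit × ℕ) : Fin (circuitDomain.size h) := ⟨h.1.n, n_lt_size h⟩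

/-- The truth assignment that makes exactly the variables in `X` true. -/
noncomputable def assignment (h : Circuit × ℕ) (X : Finset (Fin (circuitDomain.size h))) :
    Fin h.1.n → Bool :=
  fun j => decide (varElt h j ∈ X)

/-- The set of the variables in `X`. -/
noncomputable def varSet (h : Circuit × ℕ) (X : Finset (Fin (circuitDomain.size h))) :
    Finset (Fin h.1.n) :=
  Finset.univ.filter fun j => assignment h X j = true

/-- The matroid of `(C, k)`: the direct sum of the uniform matroid of rank `k` on the variables and
the free matroid on the top element. -/
def weightMatroid : circuitDomain.SetSystem := fun h =>
  {X | (∀ i ∈ X, (i : ℕ) ≤ h.1.n) ∧ (varSet h X).card ≤ h.2}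

/-- The greedoid of `(C, k)`: without the top element, the sets of at most `k + 1` variables; with
the top element, the sets of `k` variables that satisfy `C`. -/
def satGreedoid : circuitDomain.SetSystem := fun h =>
  {X | (∀ i ∈ X, (i : ℕ) ≤ h.1.n) ∧
    if topElt h ∈ X then (varSet h X).card = h.2 ∧ h.1.eval (assignment h X) = true
    else (varSet h X).card ≤ h.2 + 1}

section Combinatorics

variable {h : Circuit × ℕ} {X Y : Finset (Fin (circuitDomain.size h))}

theorem mem_varSet {j : Fin h.1.n} : j ∈ varSet h X ↔ varElt h j ∈ X := by
  simp [varSet, assignment]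

theorem varElt_injective : Function.Injective (varElt h) := fun i j hij => by
  simpa [varElt, Fin.ext_iff] using hij

theorem varElt_ne_topElt (j : Fin h.1.n) : varElt h j ≠ topElt h := by
  have := j.2
  simp only [varElt, topElt, ne_eq, Fin.mk.injEq]
  omega

theorem assignment_eq_iff : assignment h X = assignment h Y ↔ varSet h X = varSet h Y := by
  constructor
  · intro e; simp [varSet, e]
  · intro e
    funext j
    have := Finset.ext_iff.1 e j
    simpa [mem_varSet, assignment] using this

theorem varSet_insert_top : varSet h (insert (topElt h) Y) = varSet h Y := by
  ext j
  simp [mem_varSet, varElt_ne_topElt]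

theorem varSet_insert_var (j : Fin h.1.n) :
    varSet h (insert (varElt h j) Y) = insert j (varSet h Y) := by
  ext i
  simp [mem_varSet, varElt_injective.eq_iff]

theorem card_eq (hX : ∀ i ∈ X, (i : ℕ) ≤ h.1.n) :
    X.card = (varSet h X).card + if topElt h ∈ X then 1 else 0 := by
  have e : X = (varSet h X).map ⟨varElt h, varElt_injective⟩ ∪
      if topElt h ∈ X then {topElt h} else ∅ := by
    ext i
    constructor
    · intro hi
      rcases (hX i hi).lt_or_eq with hlt | heq
      · exact Finset.mem_union_left _
          (Finset.mem_map.2 ⟨⟨i, hlt⟩, mem_varSet.2 hi, rfl⟩)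
      · have : i = topElt h := Fin.ext heq
        subst this
        simp [hi]
    · intro hi
      rcases Finset.mem_union.1 hi with hi | hi
      · obtain ⟨j, hj, rfl⟩ := Finset.mem_map.1 hi
        exact mem_varSet.1 hj
      · split_ifs at hi with ht
        · exact Finset.mem_singleton.1 hi ▸ ht
        · simp at hi
  conv_lhs => rw [e]
  rw [Finset.card_union_of_disjoint, Finset.card_map]
  · split_ifs <;> simp
  · rw [Finset.disjoint_left]
    intro i hi hi'
    obtain ⟨j, -, rfl⟩ := Finset.mem_map.1 hi
    split_ifs at hi'
    · exact varElt_ne_topElt j (Finset.mem_singleton.1 hi')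
    · simp at hi'

theorem le_of_insert_var (hY : ∀ i ∈ Y, (i : ℕ) ≤ h.1.n) (j : Fin h.1.n) :
    ∀ i ∈ insert (varElt h j) Y, (i : ℕ) ≤ h.1.n := by
  intro i hi
  rcases Finset.mem_insert.1 hi with rfl | hi
  · exact j.2.le
  · exact hY i hi

theorem le_of_insert_top (hY : ∀ i ∈ Y, (i : ℕ) ≤ h.1.n) :
    ∀ i ∈ insert (topElt h) Y, (i : ℕ) ≤ h.1.n := by
  intro i hi
  rcases Finset.mem_insert.1 hi with rfl | hi
  · exact le_rfl
  · exact hY i hi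

theorem varSet_empty : varSet h ∅ = ∅ := by
  ext j
  simp [mem_varSet]

theorem isMatroid_weightMatroid (h : Circuit × ℕ) : IsMatroid (weightMatroid h) where
  empty_mem := ⟨by simp, by simp [varSet_empty]⟩
  subset_mem X Y hX hYX := ⟨fun i hi => hX.1 i (hYX hi), (Finset.card_le_card fun j hj =>
    mem_varSet.2 (hYX (mem_varSet.1 hj))).trans hX.2⟩
  exchange := by
    rintro X Y ⟨hX, hXk⟩ ⟨hY, hYk⟩ hlt
    by_cases ht : topElt h ∈ X ∧ topElt h ∉ Y
    · exact ⟨_, Finset.mem_sdiff.2 ht, le_of_insert_top hY, by rwa [varSet_insert_top]⟩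
    · have hlt' : (varSet h Y).card < (varSet h X).card := by
        rw [card_eq hX, card_eq hY] at hlt
        split_ifs at hlt <;> first | omega | tauto
      obtain ⟨j, hj, hj'⟩ := Finset.exists_mem_notMem_of_card_lt_card hlt'
      refine ⟨varElt h j, Finset.mem_sdiff.2 ⟨mem_varSet.1 hj, fun h' => hj' (mem_varSet.2 h')⟩,
        le_of_insert_var hY j, ?_⟩
      rw [varSet_insert_var, Finset.card_insert_of_notMem hj']
      omega

/-- In the exchange property the top element is never in the smaller set `Y`, because sets with the
top element have size `k + 1` and sets in the greedoid have size at most `k + 1`. If it is in the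
larger set `X`, then `X` contains `k` variables. Either one of them can be added to `Y`, or they are
exactly the variables in `Y`, and then the top element can. -/
theorem isGreedoid_satGreedoid (h : Circuit × ℕ) : IsGreedoid (satGreedoid h) where
  empty_mem := ⟨by simp, by simp [varSet_empty]⟩
  exchange := by
    rintro X Y ⟨hX, hXk⟩ ⟨hY, hYk⟩ hlt
    rw [card_eq hX, card_eq hY] at hlt
    have htY : topElt h ∉ Y := by
      intro ht
      rw [if_pos ht] at hYk hlt
      split_ifs at hXk hlt <;> omega
    rw [if_neg htY] at hYk hlt
    have key : ∀ j ∈ varSet h X, j ∉ varSet h Y → (varSet h Y).card ≤ h.2 →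
        ∃ x ∈ X \ Y, insert x Y ∈ satGreedoid h := by
      intro j hj hj' hcard
      refine ⟨varElt h j, Finset.mem_sdiff.2 ⟨mem_varSet.1 hj, fun h' => hj' (mem_varSet.2 h')⟩,
        le_of_insert_var hY j, ?_⟩
      rw [if_neg (by simp [htY, (varElt_ne_topElt j).symm]), varSet_insert_var,
        Finset.card_insert_of_notMem hj']
      omega
    by_cases ht : topElt h ∈ X
    · rw [if_pos ht] at hXk hlt
      by_cases hsub : varSet h X ⊆ varSet h Y
      -- `Y` consists of exactly the variables in `X`, so it can be completed by the top element.
      · have e : varSet h X = varSet h Y := Finset.eq_of_subset_of_card_le hsub (by omega)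
        refine ⟨_, Finset.mem_sdiff.2 ⟨ht, htY⟩, le_of_insert_top hY, ?_⟩
        rw [if_pos (Finset.mem_insert_self _ _), varSet_insert_top, ← e,
          assignment_eq_iff.2 (varSet_insert_top.trans e.symm)]
        exact hXk
      · obtain ⟨j, hj, hj'⟩ := Finset.not_subset.1 hsub
        exact key j hj hj' (by omega)
    · rw [if_neg ht] at hXk hlt
      obtain ⟨j, hj, hj'⟩ := Finset.exists_mem_notMem_of_card_lt_card
        (show (varSet h Y).card < (varSet h X).card by omega)
      exact key j hj hj' (by omega)

/-- The common feasible sets of size `k + 1` are the satisfying truth assignments of weight `k`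
together with the top element. -/
theorem weightedCircuitSat_yes_iff (C : Circuit) (k : ℕ) :
    weightedCircuitSat.yes C k ↔
      (intersectionProblem circuitDomain weightMatroid satGreedoid).yes (C, k) (k + 1) := by
  constructor
  · rintro ⟨a, ha, hk⟩
    let X : Finset (Fin (circuitDomain.size (C, k))) := insert (topElt (C, k))
      ((Finset.univ.filter fun i => a i = true).map ⟨varElt (C, k), varElt_injective⟩)
    have hX : ∀ i ∈ X, (i : ℕ) ≤ C.n := by
      intro i hi
      rcases Finset.mem_insert.1 hi with rfl | hi
      · exact le_rfl
      · obtain ⟨j, -, rfl⟩ := Finset.mem_map.1 hi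
        exact j.2.le
    have hvar : varSet (C, k) X = Finset.univ.filter fun i => a i = true := by
      ext j
      rw [mem_varSet]
      simp [X, varElt_ne_topElt]
    have hass : assignment (C, k) X = a := by
      funext j
      have := Finset.ext_iff.1 hvar j
      simp only [varSet, Finset.mem_filter, Finset.mem_univ, true_and] at this
      exact Bool.eq_iff_iff.2 this
    have ht : topElt (C, k) ∈ X := Finset.mem_insert_self _ _
    have hcard : (varSet (C, k) X).card = k := hvar ▸ hk
    refine ⟨X, ⟨⟨hX, hcard.le⟩, ⟨hX, ?_⟩⟩, ?_⟩
    · rw [if_pos ht, hass]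
      exact ⟨hcard, ha⟩
    · rw [card_eq hX, if_pos ht, hcard]
  · rintro ⟨X, ⟨⟨hX, hXk⟩, ⟨-, hG⟩⟩, hcard⟩
    rw [card_eq hX] at hcard
    split_ifs at hcard hG with ht
    · exact ⟨_, hG.2, hG.1⟩
    · dsimp only at hXk
      omega

end Combinatorics

/-! ### Stack programs over a fixed set of stacks -/

/-- The stacks of the programs below: input, output, two stacks for symbols of circuits and three
stacks for bits, of which `left` and `right` represent a tape. -/
inductive Stk
  | inp
  | out
  | code
  | tmp
  | cnt
  | left
  | right
  deriving DecidableEq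

instance : Fintype Stk where
  elems := {Stk.inp, Stk.out, Stk.code, Stk.tmp, Stk.cnt, Stk.left, Stk.right}
  complete s := by cases s <;> decide

/-- The alphabets of the stacks, for the input alphabet `A` and the output alphabet `B`. -/
def StkΓ (A B : Type) : Stk → Type
  | .inp => A
  | .out => B
  | .code => CSym
  | .tmp => CSym
  | .cnt => Bool
  | .left => Bool
  | .right => Bool

/-- Programs over the stacks `StkΓ A B`; the internal state is a buffer for each stack. -/
abbrev SProg (A B α : Type) : Type 1 := Prog (StkΓ A B) (∀ k, Option (StkΓ A B k)) α

/-- The stacks with the given contents. -/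
def st {A B : Type} (i : List A) (o : List B) (c t : List CSym) (n l r : List Bool) :
    ∀ k, List (StkΓ A B k)
  | .inp => i
  | .out => o
  | .code => c
  | .tmp => t
  | .cnt => n
  | .left => l
  | .right => r

namespace SProg

variable {A B : Type}

/-- Pop a symbol and return it. The symbol passes through the buffer of the stack. -/
def pop (k : Stk) : SProg A B (Option (StkΓ A B k)) :=
  Prog.popWith k (fun v o => Function.update v k o) fun v => v k

theorem runs_pop {k : Stk} {S S' : ∀ k, List (StkΓ A B k)}
    (h : Function.update S k (S k).tail = S') : (pop k).Runs S (S k).head? S' 1 := by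
  subst h
  exact Prog.runs_popWith (r := id) fun v o => by simp

theorem runs_push {k : Stk} {x : StkΓ A B k} {S S' : ∀ k, List (StkΓ A B k)}
    (h : Function.update S k (x :: S k) = S') :
    (Prog.push k x : SProg A B Unit).Runs S () S' 1 := by
  subst h
  exact Prog.runs_push _ _

-- The instances of `pop` and `push` for the single stacks have the alphabets in unfolded form.
def popInp : SProg A B (Option A) := pop .inp
def popCode : SProg A B (Option CSym) := pop .code
def popTmp : SProg A B (Option CSym) := pop .tmp
def popCnt : SProg A B (Option Bool) := pop .cnt
def popLeft : SProg A B (Option Bool) := pop .left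
def popRight : SProg A B (Option Bool) := pop .right
def pushOut (x : B) : SProg A B Unit := Prog.push .out x
def pushCode (x : CSym) : SProg A B Unit := Prog.push .code x
def pushTmp (x : CSym) : SProg A B Unit := Prog.push .tmp x
def pushCnt (x : Bool) : SProg A B Unit := Prog.push .cnt x
def pushLeft (x : Bool) : SProg A B Unit := Prog.push .left x
def pushRight (x : Bool) : SProg A B Unit := Prog.push .right x

variable (i : List A) (o : List B) (c t : List CSym) (n l r : List Bool)

theorem runs_popInp : popInp.Runs (st i o c t n l r) i.head? (st i.tail o c t n l r) 1 :=
  runs_pop (funext fun k => by cases k <;> rfl)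

theorem runs_popCode :
    (popCode : SProg A B _).Runs (st i o c t n l r) c.head? (st i o c.tail t n l r) 1 :=
  runs_pop (funext fun k => by cases k <;> rfl)

theorem runs_popTmp :
    (popTmp : SProg A B _).Runs (st i o c t n l r) t.head? (st i o c t.tail n l r) 1 :=
  runs_pop (funext fun k => by cases k <;> rfl)

theorem runs_popCnt :
    (popCnt : SProg A B _).Runs (st i o c t n l r) n.head? (st i o c t n.tail l r) 1 :=
  runs_pop (funext fun k => by cases k <;> rfl)

theorem runs_popLeft :
    (popLeft : SProg A B _).Runs (st i o c t n l r) l.head? (st i o c t n l.tail r) 1 :=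
  runs_pop (funext fun k => by cases k <;> rfl)

theorem runs_popRight :
    (popRight : SProg A B _).Runs (st i o c t n l r) r.head? (st i o c t n l r.tail) 1 :=
  runs_pop (funext fun k => by cases k <;> rfl)

theorem runs_pushOut (x : B) :
    (pushOut x).Runs (st i o c t n l r) () (st i (x :: o) c t n l r) 1 :=
  runs_push (funext fun k => by cases k <;> rfl)

theorem runs_pushCode (x : CSym) :
    (pushCode x : SProg A B _).Runs (st i o c t n l r) () (st i o (x :: c) t n l r) 1 :=
  runs_push (funext fun k => by cases k <;> rfl)

theorem runs_pushTmp (x : CSym) :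
    (pushTmp x : SProg A B _).Runs (st i o c t n l r) () (st i o c (x :: t) n l r) 1 :=
  runs_push (funext fun k => by cases k <;> rfl)

theorem runs_pushCnt (x : Bool) :
    (pushCnt x : SProg A B _).Runs (st i o c t n l r) () (st i o c t (x :: n) l r) 1 :=
  runs_push (funext fun k => by cases k <;> rfl)

theorem runs_pushLeft (x : Bool) :
    (pushLeft x : SProg A B _).Runs (st i o c t n l r) () (st i o c t n (x :: l) r) 1 :=
  runs_push (funext fun k => by cases k <;> rfl)

theorem runs_pushRight (x : Bool) :
    (pushRight x : SProg A B _).Runs (st i o c t n l r) () (st i o c t n l (x :: r)) 1 :=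
  runs_push (funext fun k => by cases k <;> rfl)

end SProg

/-- A program over the stacks `StkΓ A B` that turns its input into its output and leaves the other
stacks empty yields a machine. -/
theorem ComputableWithin.of_sprog {A B : Type} [Finite A] [Finite B] (p : SProg A B Unit)
    {α β : Type} {ea : α → List A} {eb : β → List B} {f : α → β} {t : α → ℕ}
    (h : ∀ a, p.Runs (st (ea a) [] [] [] [] [] []) () (st [] (eb (f a)) [] [] [] [] []) (t a)) :
    ComputableWithin ea eb f (fun a => t a + 1) := by
  have : ∀ k, Finite (StkΓ A B k) := by
    intro k
    cases k <;> (unfold StkΓ; dsimp only; infer_instance)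
  refine ComputableWithin.of_prog (K := Stk) (Γ := StkΓ A B) (fun _ => none) (k₀ := .inp)
    (k₁ := .out) (.refl _) (.refl _) p fun a => ?_
  have e₁ : single (Γ := StkΓ A B) .inp (ea a) = st (ea a) [] [] [] [] [] [] :=
    funext fun k => by cases k <;> rfl
  have e₂ : single (Γ := StkΓ A B) .out (eb (f a)) = st [] (eb (f a)) [] [] [] [] [] :=
    funext fun k => by cases k <;> rfl
  have e₃ : (ea a).map (Equiv.refl A).symm = ea a := List.map_id _
  have e₄ : (eb (f a)).map (Equiv.refl B).symm = eb (f a) := List.map_id _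
  have := h a
  rw [← e₁, ← e₂, ← e₃, ← e₄] at this
  exact this

/-! ### Loops -/

section Loops

variable {K σ A β τ : Type} [DecidableEq K] {Γ : K → Type} [Finite A] [Finite β]

/-- The body of the loop `Prog.foldPop`. -/
def Prog.foldPopBody (p : Prog Γ σ (Option A)) (f : β → A → Prog Γ σ β) (b : β) :
    Prog Γ σ (β ⊕ β) :=
  p.bind fun o => o.elim (Prog.ret (.inr b)) fun x => (f b x).bind fun b' => Prog.ret (.inl b')

theorem Prog.runs_foldPopBody_none {p : Prog Γ σ (Option A)} {f : β → A → Prog Γ σ β} {b : β}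
    {S S₁ : ∀ k, List (Γ k)} {m : ℕ} (hp : p.Runs S none S₁ m) :
    (foldPopBody p f b).Runs S (.inr b) S₁ (m + 1) :=
  Runs.bind hp (runs_ret (Sum.inr b))

theorem Prog.runs_foldPopBody_some {p : Prog Γ σ (Option A)} {f : β → A → Prog Γ σ β} {b b' : β}
    {x : A} {S S₁ S₂ : ∀ k, List (Γ k)} {m n : ℕ} (hp : p.Runs S (some x) S₁ m)
    (hf : (f b x).Runs S₁ b' S₂ n) :
    (foldPopBody p f b).Runs S (.inl b') S₂ (m + (n + 1)) :=
  Runs.bind hp (Runs.bind hf (runs_ret (Sum.inl b')))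

/-- Pop symbols until the stack is empty, and carry a value through the actions on them. -/
def Prog.foldPop (p : Prog Γ σ (Option A)) (f : β → A → Prog Γ σ β) (b : β) : Prog Γ σ β :=
  Prog.iter (foldPopBody p f) b

/-- The effect of a loop over the symbols of a stack is a fold over its contents. Here `s` is the
abstract state, `S s w` are the stacks and `g s` is the value in state `s` with remaining word `w`,
and `P` is an invariant. -/
theorem Prog.runs_foldPop {p : Prog Γ σ (Option A)} {f : β → A → Prog Γ σ β}
    (S : τ → List A → ∀ k, List (Γ k)) (g : τ → β) (step : τ → A → τ) (P : τ → List A → Prop)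
    (c : ℕ) (hP : ∀ s x w, P s (x :: w) → P (step s x) w)
    (hp : ∀ s w, p.Runs (S s w) w.head? (S s w.tail) 1)
    (hf : ∀ s x w, P s (x :: w) → (f (g s) x).Runs (S s w) (g (step s x)) (S (step s x) w) c)
    (s : τ) (w : List A) (hs : P s w) :
    (foldPop p f (g s)).Runs (S s w) (g (w.foldl step s)) (S (w.foldl step s) [])
      ((c + 2) * w.length + 2) := by
  induction w generalizing s with
  | nil => exact (Runs.iter_stop (runs_foldPopBody_none (hp s []))).mono (by simp)
  | cons x w ih =>
    refine (Runs.iter_next (runs_foldPopBody_some (hp s (x :: w)) (hf s x w hs))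
      (ih (step s x) (hP s x w hs))).mono ?_
    rw [List.length_cons]
    ring_nf
    omega

end Loops

namespace SProg

variable {A B : Type}

/-- Turn the tape back: move the contents of `left` to `right`. -/
def rewind : SProg A B Unit := Prog.foldPop popLeft (fun _ x => pushRight x) ()

/-- Move the contents of `right` to `left`. -/
def forward : SProg A B Unit := Prog.foldPop popRight (fun _ x => pushLeft x) ()

theorem foldl_cons_eq {α : Type} (l m : List α) :
    l.foldl (fun s x => x :: s) m = l.reverse ++ m := by
  induction l generalizing m with
  | nil => rfl
  | cons x l ih => simp [ih]

variable (i : List A) (o : List B) (c t : List CSym) (n l r : List Bool)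

theorem runs_rewind : (rewind : SProg A B _).Runs (st i o c t n l r) ()
    (st i o c t n [] (l.reverse ++ r)) (3 * l.length + 2) := by
  rw [← foldl_cons_eq]
  exact Prog.runs_foldPop (fun s w => st i o c t n w s) (fun _ => ()) (fun s x => x :: s)
    (fun _ _ => True) 1 (fun _ _ _ _ => trivial) (fun s w => runs_popLeft i o c t n w s)
    (fun s x w _ => runs_pushRight i o c t n w s x) r l trivial

theorem runs_forward : (forward : SProg A B _).Runs (st i o c t n l r) ()
    (st i o c t n (r.reverse ++ l) []) (3 * r.length + 2) := by
  rw [← foldl_cons_eq]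
  exact Prog.runs_foldPop (fun s w => st i o c t n s w) (fun _ => ()) (fun s x => x :: s)
    (fun _ _ => True) 1 (fun _ _ _ _ => trivial) (fun s w => runs_popRight i o c t n s w)
    (fun s x w _ => runs_pushLeft i o c t n s w x) l r trivial

end SProg

/-! ### The size of a domain and the reduction -/

theorem circuitDomain_encode (h : Circuit × ℕ) : circuitDomain.enc.encode h =
    h.1.code.map .inl ++ List.replicate h.2 (.inr true) :=
  weightedCircuitSat.encPair_eq h.1 h.2

/-- Replace each symbol of the input by a tick. -/
def sizeProg : SProg (CSym ⊕ Bool) Bool Unit :=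
  Prog.foldPop SProg.popInp (fun _ _ => SProg.pushOut true) ()

theorem runs_sizeProg (w : List (CSym ⊕ Bool)) : sizeProg.Runs (st w [] [] [] [] [] []) ()
    (st [] (List.replicate w.length true) [] [] [] [] []) (3 * w.length + 2) := by
  have e : ∀ (w : List (CSym ⊕ Bool)) (s : List Bool),
      w.foldl (fun s _ => true :: s) s = List.replicate w.length true ++ s := by
    intro w
    induction w with
    | nil => intro s; rfl
    | cons x w ih =>
      intro s
      rw [List.foldl_cons, ih, List.length_cons, List.replicate_succ']
      simp
  have := Prog.runs_foldPop (p := SProg.popInp) (f := fun _ _ => SProg.pushOut true)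
    (fun s (w : List (CSym ⊕ Bool)) => st w s [] [] [] [] []) (fun _ => ())
    (fun s _ => true :: s) (fun _ _ => True) 1 (fun _ _ _ _ => trivial)
    (fun s w => SProg.runs_popInp w s _ _ _ _ _)
    (fun s x w _ => SProg.runs_pushOut w s _ _ _ _ _ true) [] w trivial
  rw [e, List.append_nil] at this
  exact this

theorem isPolyTime_circuitDomain : circuitDomain.IsPolyTime := by
  have hc : ComputableWithin circuitDomain.enc.encode Computability.unaryEncodeNat
      circuitDomain.size fun h => 3 * (circuitDomain.enc.encode h).length + 2 + 1 :=
    ComputableWithin.of_sprog sizeProg fun h => by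
      rw [unaryEncodeNat_eq_replicate]
      exact runs_sizeProg _
  obtain ⟨M, hM⟩ := hc
  refine ⟨⟨M, 3 * Polynomial.X + 3, fun h => ?_⟩⟩
  have e : (3 * Polynomial.X + 3 : Polynomial ℕ).eval (circuitDomain.enc.encode h).length =
      3 * (circuitDomain.enc.encode h).length + 2 + 1 := by simp
  rw [e]
  exact (hM h).some

/-- The program of the reduction: it copies the code of a pair of a circuit and a weight `k` and
puts `k + 1` ticks behind it. -/
def copyProg : SProg (CSym ⊕ Bool) ((CSym ⊕ Bool) ⊕ Bool) Unit :=
  (SProg.pushOut (.inr true)).seq <|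
  (Prog.foldPop SProg.popInp (fun _ x => x.elim SProg.pushTmp fun b =>
    (SProg.pushCnt b).seq (SProg.pushOut (.inr true))) ()).seq <|
  (Prog.foldPop SProg.popCnt (fun _ b => SProg.pushOut (.inl (.inr b))) ()).seq <|
  Prog.foldPop SProg.popTmp (fun _ s => SProg.pushOut (.inl (.inl s))) ()

theorem foldl_cons_map_eq {α β : Type} (g : α → β) (l : List α) (m : List β) :
    l.foldl (fun s x => g x :: s) m = (l.map g).reverse ++ m := by
  induction l generalizing m with
  | nil => rfl
  | cons x l ih => simp [ih]

theorem runs_copyProg (u : List CSym) (k : ℕ) :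
    copyProg.Runs (st (u.map .inl ++ List.replicate k (.inr true)) [] [] [] [] [] []) ()
      (st [] ((u.map Sum.inl ++ List.replicate k (Sum.inr true)).map Sum.inl ++
        List.replicate (k + 1) (Sum.inr true)) [] [] [] [] []) (7 * (u.length + k) + 7) := by
  let step : List CSym × List Bool × List ((CSym ⊕ Bool) ⊕ Bool) → CSym ⊕ Bool →
      List CSym × List Bool × List ((CSym ⊕ Bool) ⊕ Bool) := fun s x =>
    x.elim (fun y => (y :: s.1, s.2)) (fun b => (s.1, b :: s.2.1, Sum.inr true :: s.2.2))
  have e₁ : ∀ (u : List CSym) (s), (u.map Sum.inl).foldl step s = (u.reverse ++ s.1, s.2) := by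
    intro u
    induction u with
    | nil => intro s; rfl
    | cons x u ih => intro s; rw [List.map_cons, List.foldl_cons, ih]; simp [step]
  have e₂ : ∀ (k : ℕ) (s), (List.replicate k (Sum.inr true)).foldl step s =
      (s.1, List.replicate k true ++ s.2.1, List.replicate k (Sum.inr true) ++ s.2.2) := by
    intro k
    induction k with
    | zero => intro s; rfl
    | succ k ih =>
      intro s
      rw [List.replicate_succ, List.foldl_cons, ih, List.replicate_succ', List.replicate_succ']
      simp [step]
  have hf : ∀ s x (w : List (CSym ⊕ Bool)), (Sum.elim SProg.pushTmp (fun b =>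
      (SProg.pushCnt b).seq (SProg.pushOut (.inr true))) x).Runs
      (st w s.2.2 [] s.1 s.2.1 [] []) ()
      (st w (step s x).2.2 [] (step s x).1 (step s x).2.1 [] []) 2 := by
    rintro s (y | b) w
    · exact (SProg.runs_pushTmp _ _ _ _ _ _ _ _).mono (by omega)
    · exact (SProg.runs_pushCnt _ _ _ _ _ _ _ _).seq
        (SProg.runs_pushOut _ _ _ _ _ _ _ _)
  have h₁ := Prog.runs_foldPop (p := SProg.popInp)
    (f := fun _ (x : CSym ⊕ Bool) => x.elim SProg.pushTmp fun b =>
      (SProg.pushCnt b).seq (SProg.pushOut (.inr true)))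
    (fun (s : List CSym × List Bool × List ((CSym ⊕ Bool) ⊕ Bool)) w =>
      st (A := CSym ⊕ Bool) w s.2.2 [] s.1 s.2.1 [] []) (fun _ => ()) step (fun _ _ => True) 2
    (fun _ _ _ _ => trivial) (fun s w => SProg.runs_popInp w _ _ _ _ _ _)
    (fun s x w _ => hf s x w) ([], [], [.inr true]) (u.map .inl ++ List.replicate k (.inr true))
    trivial
  have h₂ := fun i o c t l r => Prog.runs_foldPop (p := SProg.popCnt)
    (f := fun _ b => SProg.pushOut (.inl (.inr b)))
    (fun (s : List ((CSym ⊕ Bool) ⊕ Bool)) w => st (A := CSym ⊕ Bool) i s c t w l r)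
    (fun _ => ()) (fun s b => .inl (.inr b) :: s) (fun _ _ => True) 1 (fun _ _ _ _ => trivial)
    (fun s w => SProg.runs_popCnt _ _ _ _ _ _ _)
    (fun s x w _ => SProg.runs_pushOut _ _ _ _ _ _ _ _) o (List.replicate k true) trivial
  have h₃ := fun i o c n l r => Prog.runs_foldPop (p := SProg.popTmp)
    (f := fun _ b => SProg.pushOut (.inl (.inl b)))
    (fun (s : List ((CSym ⊕ Bool) ⊕ Bool)) w => st (A := CSym ⊕ Bool) i s c w n l r)
    (fun _ => ()) (fun s b => .inl (.inl b) :: s) (fun _ _ => True) 1 (fun _ _ _ _ => trivial)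
    (fun s w => SProg.runs_popTmp _ _ _ _ _ _ _)
    (fun s x w _ => SProg.runs_pushOut _ _ _ _ _ _ _ _) o u.reverse trivial
  rw [List.foldl_append, e₁, e₂, List.append_nil, List.append_nil] at h₁
  simp only [foldl_cons_map_eq] at h₂ h₃
  have h := (SProg.runs_pushOut (A := CSym ⊕ Bool) (u.map .inl ++ List.replicate k (.inr true))
    ([] : List ((CSym ⊕ Bool) ⊕ Bool)) [] [] [] [] [] (.inr true)).seq
    (h₁.seq ((h₂ _ _ _ _ _ _).seq (h₃ _ _ _ _ _ _)))
  have e : (u.map Sum.inl ++ List.replicate k (Sum.inr true)).map Sum.inl ++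
      List.replicate (k + 1) (Sum.inr true) =
      (u.reverse.map fun x => Sum.inl (Sum.inl x)).reverse ++
        (((List.replicate k true).map fun b => Sum.inl (Sum.inr b)).reverse ++
          (List.replicate k (Sum.inr true) ++ [Sum.inr true])) := by
    simp [List.replicate_succ']
  rw [e]
  refine h.mono ?_
  simp only [List.length_append, List.length_map, List.length_replicate, List.length_reverse]
  omega

/-- The reduction maps `(C, k)` to the index `(C, k)` and the parameter `k + 1`. -/
theorem reducesVia_intersectionProblem : ReducesVia weightedCircuitSat
    (intersectionProblem circuitDomain weightMatroid satGreedoid) (fun k => k + 1) := by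
  refine ⟨fun C k => (C, k), fun k => 7 * k + 8, 1, ?_, weightedCircuitSat_yes_iff⟩
  refine ComputableWithin.mono (ComputableWithin.of_sprog copyProg
    (t := fun p => 7 * (p.1.code.length + p.2) + 7) fun p => ?_) fun p => ?_
  · obtain ⟨C, k⟩ := p
    have e₁ := weightedCircuitSat.encPair_eq C k
    have e₂ := (intersectionProblem circuitDomain weightMatroid satGreedoid).encPair_eq (C, k)
      (k + 1)
    have h := runs_copyProg C.code k
    have e₃ : List.map Sum.inl (circuitDomain.enc.encode (C, k)) ++
        List.replicate (k + 1) (Sum.inr true) =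
        (C.code.map Sum.inl ++ List.replicate k (Sum.inr true)).map Sum.inl ++
          List.replicate (k + 1) (Sum.inr true) :=
      congrArg (fun w => List.map Sum.inl w ++ List.replicate (k + 1) (Sum.inr true))
        (circuitDomain_encode (C, k))
    exact e₁ ▸ (e₂.trans e₃) ▸ h
  · change _ ≤ (7 * p.2 + 8) * (p.1.code.length + 1) ^ 1
    nlinarith [Nat.zero_le (p.2 * p.1.code.length)]

/-! ### The evaluation of a circuit -/

/-- The values of the wires after the gate in progress, if any, is completed. A gate in progress is
represented by its type and the value of the arguments read so far. -/
def flush (q : Option (CSym × Bool)) (v : List Bool) : List Bool := v ++ (q.map Prod.snd).toList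

/-- The value of a gate of type `s` after a further argument `b`, if its value was `acc`. -/
def combine (s : CSym) (acc b : Bool) : Bool :=
  match s with
  | .and => acc && b
  | .or => acc || b
  | .not => !b
  | _ => acc

/-- The effect of a symbol of the code of a circuit on the gate in progress and on the tape of the
wire values, with contents `s.2.1.reverse ++ s.2.2` and the head at the first symbol of `s.2.2`. -/
def gateNext (s : Option (CSym × Bool) × List Bool × List Bool) :
    CSym → Option (CSym × Bool) × List Bool × List Bool
  | .tick => (s.1, s.2.2.head?.toList ++ s.2.1, s.2.2.tail)
  | .mark => (s.1.map fun p => (p.1, combine p.1 p.2 (s.2.2.head?.getD false)), [],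
      s.2.1.reverse ++ s.2.2)
  | .and => (some (.and, true), [], flush s.1 (s.2.1.reverse ++ s.2.2))
  | .or => (some (.or, false), [], flush s.1 (s.2.1.reverse ++ s.2.2))
  | .not => (some (.not, false), [], flush s.1 (s.2.1.reverse ++ s.2.2))

theorem foldl_gateNext_ticks (i : ℕ) (q : Option (CSym × Bool)) (l r : List Bool) :
    (List.replicate i CSym.tick).foldl gateNext (q, l, r) =
      (q, (r.take i).reverse ++ l, r.drop i) := by
  induction i generalizing l r with
  | zero => simp
  | succ i ih =>
    rw [List.replicate_succ, List.foldl_cons]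
    cases r with
    | nil => simpa [gateNext] using ih l []
    | cons x r => simp [gateNext, ih]

theorem foldl_gateNext_codeNat (i : ℕ) (s : CSym) (acc : Bool) (v : List Bool) :
    (codeNat i).foldl gateNext (some (s, acc), [], v) =
      (some (s, combine s acc (v.getD i false)), [], v) := by
  rw [codeNat, List.foldl_append, foldl_gateNext_ticks]
  simp [gateNext, List.head?_drop]

theorem foldl_gateNext_args (is : List ℕ) (s : CSym) (acc : Bool) (v : List Bool) :
    (is.flatMap codeNat).foldl gateNext (some (s, acc), [], v) =
      (some (s, is.foldl (fun acc i => combine s acc (v.getD i false)) acc), [], v) := by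
  induction is generalizing acc with
  | nil => rfl
  | cons i is ih =>
    rw [List.flatMap_cons, List.foldl_append, foldl_gateNext_codeNat, ih, List.foldl_cons]

theorem foldl_combine_and (is : List ℕ) (v : List Bool) (acc : Bool) :
    is.foldl (fun acc i => combine .and acc (v.getD i false)) acc =
      (acc && is.all fun i => v.getD i false) := by
  induction is generalizing acc with
  | nil => simp
  | cons i is ih => rw [List.foldl_cons, ih, List.all_cons, combine, Bool.and_assoc]

theorem foldl_combine_or (is : List ℕ) (v : List Bool) (acc : Bool) :
    is.foldl (fun acc i => combine .or acc (v.getD i false)) acc =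
      (acc || is.any fun i => v.getD i false) := by
  induction is generalizing acc with
  | nil => simp
  | cons i is ih => rw [List.foldl_cons, ih, List.any_cons, combine, Bool.or_assoc]

theorem foldl_gateNext_gate (g : Gate) (q : Option (CSym × Bool)) (v : List Bool) :
    ∃ s, g.code.foldl gateNext (q, [], v) =
      (some (s, g.eval (flush q v)), [], flush q v) := by
  cases g with
  | and is =>
    refine ⟨.and, ?_⟩
    rw [Gate.code, List.foldl_cons]
    refine (foldl_gateNext_args is .and true (flush q v)).trans ?_
    rw [foldl_combine_and, Bool.true_and, Gate.eval]
  | or is =>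
    refine ⟨.or, ?_⟩
    rw [Gate.code, List.foldl_cons]
    refine (foldl_gateNext_args is .or false (flush q v)).trans ?_
    rw [foldl_combine_or, Bool.false_or, Gate.eval]
  | not i => exact ⟨.not, foldl_gateNext_codeNat i .not false (flush q v)⟩

/-- Reading the code of a list of gates, with the last one completed at the end, evaluates them. -/
theorem foldl_gateNext_gates (gs : List Gate) (q : Option (CSym × Bool)) (v : List Bool) :
    ∃ q' v', (gs.flatMap Gate.code).foldl gateNext (q, [], v) = (q', [], v') ∧
      flush q' v' = gs.foldl (fun v g => v ++ [g.eval v]) (flush q v) := by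
  induction gs generalizing q v with
  | nil => exact ⟨q, v, rfl, rfl⟩
  | cons g gs ih =>
    obtain ⟨s, hs⟩ := foldl_gateNext_gate g q v
    obtain ⟨q', v', h₁, h₂⟩ := ih (some (s, g.eval (flush q v))) (flush q v)
    refine ⟨q', v', ?_, h₂⟩
    rw [List.flatMap_cons, List.foldl_append, hs, h₁]

theorem length_foldl_gates_le (gs : List Gate) (v : List Bool) :
    (gs.foldl (fun v g => v ++ [g.eval v]) v).length ≤
      v.length + (gs.flatMap Gate.code).length := by
  induction gs generalizing v with
  | nil => exact le_rfl
  | cons g gs ih =>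
    have h₁ := ih (v ++ [g.eval v])
    have h₂ : 1 ≤ g.code.length := by cases g <;> simp [Gate.code]
    rw [List.length_append, List.length_singleton] at h₁
    rw [List.foldl_cons, List.flatMap_cons, List.length_append]
    omega

/-- Programs that read a query and write a bit. -/
abbrev QProg (α : Type) : Type 1 := SProg ((CSym ⊕ Bool) ⊕ Bool) Bool α

section

variable (i : List ((CSym ⊕ Bool) ⊕ Bool)) (o : List Bool) (c t : List CSym) (n l r : List Bool)

/-- Complete the gate in progress and turn back the tape. -/
def appendGate (q : Option (CSym × Bool)) : QProg Unit :=
  q.elim SProg.rewind fun p => SProg.forward.seq ((SProg.pushRight p.2).seq SProg.rewind)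

theorem runs_appendGate (q : Option (CSym × Bool)) :
    (appendGate q).Runs (st i o c t n l r) () (st i o c t n [] (flush q (l.reverse ++ r)))
      (6 * (l.length + r.length) + 5) := by
  cases q with
  | none =>
    have := SProg.runs_rewind i o c t n l r
    simp only [flush, Option.map_none, Option.toList_none, List.append_nil]
    exact this.mono (by omega)
  | some p =>
    have := (SProg.runs_forward i o c t n l r).seq ((SProg.runs_pushRight i o c t n _ _ p.2).seq
      (SProg.runs_rewind i o c t n _ _))
    have e : flush (some p) (l.reverse ++ r) = (r.reverse ++ l).reverse ++ [p.2] := by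
      simp [flush]
    rw [e]
    refine this.mono ?_
    simp only [List.length_append, List.length_reverse]
    omega

/-- Treat a symbol of the code of a circuit. -/
def gateStep (q : Option (CSym × Bool)) : CSym → QProg (Option (CSym × Bool))
  | .tick => SProg.popRight.bind fun o =>
      o.elim (Prog.ret q) fun b => (SProg.pushLeft b).seq (Prog.ret q)
  | .mark => SProg.popRight.bind fun o => (o.elim (Prog.ret ()) SProg.pushRight).seq <|
      SProg.rewind.seq <|
      Prog.ret (q.map fun p => (p.1, combine p.1 p.2 (o.getD false)))
  | .and => (appendGate q).seq (Prog.ret (some (.and, true)))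
  | .or => (appendGate q).seq (Prog.ret (some (.or, false)))
  | .not => (appendGate q).seq (Prog.ret (some (.not, false)))

theorem runs_gateStep (q : Option (CSym × Bool)) (x : CSym) {W : ℕ}
    (hW : l.length + r.length ≤ W) :
    (gateStep q x).Runs (st i o c t n l r) (gateNext (q, l, r) x).1
      (st i o c t n (gateNext (q, l, r) x).2.1 (gateNext (q, l, r) x).2.2) (6 * W + 6) := by
  have happ := runs_appendGate i o c t n l r q
  cases x with
  | tick =>
    refine Prog.Runs.mono (m := 3) ?_ (by omega)
    cases r with
    | nil => exact ((SProg.runs_popRight i o c t n l []).bind (Prog.runs_ret q)).mono (by omega)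
    | cons b r =>
      refine Prog.Runs.bind (m := 1) (n := 2) (SProg.runs_popRight i o c t n l (b :: r)) ?_
      exact ((SProg.runs_pushLeft i o c t n l r b).seq (Prog.runs_ret q))
  | mark =>
    have h : ((r.head?.elim (Prog.ret ()) SProg.pushRight).seq (SProg.rewind.seq
        (Prog.ret (q.map fun p => (p.1, combine p.1 p.2 (r.head?.getD false))))) :
        QProg _).Runs (st i o c t n l r.tail)
        (q.map fun p => (p.1, combine p.1 p.2 (r.head?.getD false)))
        (st i o c t n [] (l.reverse ++ r)) (1 + (3 * l.length + 2 + 1)) := by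
      refine Prog.Runs.seq (S₁ := st i o c t n l r) ?_
        ((SProg.runs_rewind i o c t n l r).seq (Prog.runs_ret _))
      cases r with
      | nil => exact Prog.runs_ret ()
      | cons b r => exact SProg.runs_pushRight i o c t n l r b
    exact ((SProg.runs_popRight i o c t n l r).bind h).mono (by omega)
  | and => exact (happ.seq (Prog.runs_ret _)).mono (by omega)
  | or => exact (happ.seq (Prog.runs_ret _)).mono (by omega)
  | not => exact (happ.seq (Prog.runs_ret _)).mono (by omega)

theorem length_gateNext_le (q : Option (CSym × Bool)) (x : CSym) :
    (gateNext (q, l, r) x).2.1.length + (gateNext (q, l, r) x).2.2.length ≤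
      l.length + r.length + 1 := by
  have h : ∀ v, (flush q v).length ≤ v.length + 1 := by
    intro v
    cases q <;> simp [flush]
  have h' := h (l.reverse ++ r)
  simp only [List.length_append, List.length_reverse] at h'
  cases x with
  | tick => cases r <;> simp [gateNext]; omega
  | mark => simp [gateNext]
  | and => simpa [gateNext] using h'
  | or => simpa [gateNext] using h'
  | not => simpa [gateNext] using h'

/-- Extend the list of the values of the variables to the list of the values of all wires. -/
def evalGates : QProg Unit := (Prog.foldPop SProg.popCode gateStep none).bind appendGate

/-- Each symbol of the code costs at most a constant number of passes over the tape, which never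
holds more than `W` values. -/
theorem runs_evalGates (gs : List Gate) (v : List Bool) {W : ℕ}
    (hW : v.length + (gs.flatMap Gate.code).length ≤ W) :
    evalGates.Runs (st i o (gs.flatMap Gate.code) t n [] v) ()
      (st i o [] t n [] (gs.foldl (fun v g => v ++ [g.eval v]) v))
      ((6 * W + 8) * (gs.flatMap Gate.code).length + 2 + (6 * W + 5)) := by
  have h := Prog.runs_foldPop (p := SProg.popCode) (f := gateStep)
    (fun (s : Option (CSym × Bool) × List Bool × List Bool) w => st i o w t n s.2.1 s.2.2)
    (fun s => s.1) gateNext (fun s w => s.2.1.length + s.2.2.length + w.length ≤ W) (6 * W + 6)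
    (fun s x w hs => by
      have := length_gateNext_le s.2.1 s.2.2 s.1 x
      rw [List.length_cons] at hs
      change (gateNext s x).2.1.length + (gateNext s x).2.2.length ≤ _ at this
      omega)
    (fun s w => SProg.runs_popCode i o w t n _ _)
    (fun s x w hs => runs_gateStep i o w t n s.2.1 s.2.2 s.1 x (by omega))
    (none, [], v) (gs.flatMap Gate.code) (by simpa using hW)
  obtain ⟨q', v', h₁, h₂⟩ := foldl_gateNext_gates gs none v
  have h₃ : v'.length ≤ W := by
    have := length_foldl_gates_le gs v
    have h₂' := congrArg List.length h₂
    simp only [flush, Option.map_none, Option.toList_none, List.append_nil,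
      List.length_append] at h₂'
    omega
  rw [h₁] at h
  have h' := h.bind (runs_appendGate i o [] t n [] v' q')
  rw [List.reverse_nil, List.nil_append, h₂, show flush none v = v by simp [flush]] at h'
  refine Prog.Runs.mono h' ?_
  change (6 * W + 8) * _ + 2 + _ ≤ _
  rw [List.length_nil]
  omega

/-! ### Reading numbers -/

/-- The body of the loop `readNat`. -/
def readNatBody {β : Type} [Finite β] (f : β → QProg β) (b : β) : QProg (β ⊕ β) :=
  SProg.popCode.bind fun o =>
    if o = some .tick then (f b).bind fun b' => Prog.ret (.inl b') else Prog.ret (.inr b)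

/-- Repeat an action for each tick of a number at the beginning of the code. -/
def readNat {β : Type} [Finite β] (f : β → QProg β) (b : β) : QProg β :=
  Prog.iter (readNatBody f) b

/-- The effect of reading `m` is the `m`-fold iterate of the effect of the action, with abstract
states as in `Prog.runs_foldPop`. -/
theorem runs_readNat {β τ : Type} [Finite β] {f : β → QProg β}
    (S : τ → List CSym → ∀ k, List (StkΓ ((CSym ⊕ Bool) ⊕ Bool) Bool k)) (g : τ → β)
    (step : τ → τ) (c : ℕ)
    (hp : ∀ s w, SProg.popCode.Runs (S s w) w.head? (S s w.tail) 1)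
    (hf : ∀ s w, (f (g s)).Runs (S s w) (g (step s)) (S (step s) w) c) (s : τ) (m : ℕ)
    (w : List CSym) : (readNat f (g s)).Runs (S s (codeNat m ++ w)) (g (step^[m] s))
      (S (step^[m] s) w) ((c + 2) * m + 2) := by
  induction m generalizing s with
  | zero =>
    refine Prog.Runs.iter_stop (Prog.Runs.bind (m := 1) (n := 1) (hp s (CSym.mark :: w)) ?_)
    exact Prog.runs_ret (Sum.inr (g s))
  | succ m ih =>
    have h : (readNatBody f (g s)).Runs (S s (codeNat (m + 1) ++ w))
        (.inl (g (step s))) (S (step s) (codeNat m ++ w))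
        (1 + (c + 1)) := by
      refine Prog.Runs.bind (hp s (CSym.tick :: (codeNat m ++ w))) ?_
      exact Prog.Runs.bind (hf s _) (Prog.runs_ret (Sum.inl (g (step s))))
    refine (Prog.Runs.iter_next h (ih (step s))).mono ?_
    ring_nf
    omega

/-- The number `min m 2`. -/
def sat : ℕ → Fin 3
  | 0 => 0
  | 1 => 1
  | _ => 2

/-- The map `sat m ↦ sat (m + 1)`. -/
def bump (d : Fin 3) : Fin 3 := if d = 0 then 1 else 2

theorem bump_sat (m : ℕ) : bump (sat m) = sat (m + 1) := by
  match m with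
  | 0 => rfl
  | 1 => rfl
  | m + 2 => rfl

/-- Move a bit from `right` to `left`; if it is `true`, then remove a symbol of `cnt`, or count it
if there is none. -/
def countVar (d : Fin 3) : QProg (Fin 3) :=
  SProg.popRight.bind fun o => (SProg.pushLeft (o.getD false)).seq <|
    if o.getD false then SProg.popCnt.bind fun q => Prog.ret (if q = none then bump d else d)
    else Prog.ret d

/-- The effect of `countVar` on its value and the stacks `cnt`, `left` and `right`. -/
def countVarNext (s : Fin 3 × List Bool × List Bool × List Bool) :
    Fin 3 × List Bool × List Bool × List Bool :=
  if s.2.2.2.head?.getD false then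
    (if s.2.1.head? = none then bump s.1 else s.1, s.2.1.tail, true :: s.2.2.1, s.2.2.2.tail)
  else (s.1, s.2.1, false :: s.2.2.1, s.2.2.2.tail)

theorem runs_countVar (d : Fin 3) : (countVar d).Runs (st i o c t n l r)
    (countVarNext (d, n, l, r)).1 (st i o c t (countVarNext (d, n, l, r)).2.1
      (countVarNext (d, n, l, r)).2.2.1 (countVarNext (d, n, l, r)).2.2.2) 4 := by
  refine Prog.Runs.bind (m := 1) (n := 3) (SProg.runs_popRight i o c t n l r) ?_
  refine Prog.Runs.seq (m := 1) (n := 2) (SProg.runs_pushLeft i o c t n l r.tail _) ?_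
  unfold countVarNext
  dsimp only
  cases r.head?.getD false with
  | false => exact (Prog.runs_ret d).mono (by omega)
  | true =>
    refine Prog.Runs.bind (m := 1) (n := 1) (SProg.runs_popCnt i o c t n _ _) ?_
    exact Prog.runs_ret (if n.head? = none then bump d else d)

/-- After `j` variables of value `true` have been counted, the value is `sat (j - k)` and `k - j`
ticks are left on `cnt`: the truncated subtractions tell the excess over `k` and the rest. -/
theorem countVarNext_iterate (k j : ℕ) (a l r : List Bool) :
    countVarNext^[a.length] (sat (j - k), List.replicate (k - j) true, l, a ++ r) =
      (sat (j + a.count true - k), List.replicate (k - (j + a.count true)) true,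
        a.reverse ++ l, r) := by
  induction a generalizing j l with
  | nil => rfl
  | cons x a ih =>
    rw [List.length_cons, Function.iterate_succ_apply]
    cases x with
    | false =>
      have := ih j (false :: l)
      simpa [countVarNext] using this
    | true =>
      have e : countVarNext (sat (j - k), List.replicate (k - j) true, l, true :: a ++ r) =
          (sat (j + 1 - k), List.replicate (k - (j + 1)) true, true :: l, a ++ r) := by
        rcases Nat.lt_or_ge j k with hjk | hjk
        · obtain ⟨m, rfl⟩ := Nat.exists_eq_add_of_lt hjk
          have e₁ : j + m + 1 - j = m + 1 := by omega
          have e₂ : j + m + 1 - (j + 1) = m := by omega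
          have e₃ : j - (j + m + 1) = j + 1 - (j + m + 1) := by omega
          simp [countVarNext, e₁, e₂, e₃, List.replicate_succ]
        · have e₁ : k - j = 0 := by omega
          have e₂ : k - (j + 1) = 0 := by omega
          have e₃ : j + 1 - k = j - k + 1 := by omega
          simp [countVarNext, e₁, e₂, e₃, bump_sat]
      rw [e, ih (j + 1) (true :: l), List.count_cons_self]
      simp [Nat.add_assoc, Nat.add_comm 1]

end

/-! ### The oracle program -/

section

/-- Distribute a query over the stacks: the code of the circuit goes to `tmp`, the weight to `cnt`
and the set to `left`. -/
def splitQuery : QProg Unit :=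
  Prog.foldPop SProg.popInp (fun _ x =>
    x.elim (fun y => y.elim SProg.pushTmp SProg.pushCnt) SProg.pushLeft) ()

/-- The code of a query. -/
def queryCode (u : List CSym) (k : ℕ) (b : List Bool) : List ((CSym ⊕ Bool) ⊕ Bool) :=
  (u.map Sum.inl ++ List.replicate k (Sum.inr true)).map Sum.inl ++ b.map Sum.inr

theorem runs_splitQuery (u : List CSym) (k : ℕ) (b : List Bool) :
    splitQuery.Runs (st (queryCode u k b) [] [] [] [] [] []) ()
      (st [] [] [] u.reverse (List.replicate k true) b.reverse [])
      (3 * (u.length + k + b.length) + 2) := by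
  let step : List CSym × List Bool × List Bool → (CSym ⊕ Bool) ⊕ Bool →
      List CSym × List Bool × List Bool := fun s x =>
    x.elim (fun y => y.elim (fun z => (z :: s.1, s.2)) (fun z => (s.1, z :: s.2.1, s.2.2)))
      (fun z => (s.1, s.2.1, z :: s.2.2))
  have e₁ : ∀ (u : List CSym) (s), ((u.map Sum.inl).map Sum.inl).foldl step s =
      (u.reverse ++ s.1, s.2) := by
    intro u
    induction u with
    | nil => intro s; rfl
    | cons x u ih => intro s; rw [List.map_cons, List.map_cons, List.foldl_cons, ih]; simp [step]
  have e₂ : ∀ (k : ℕ) (s), ((List.replicate k (Sum.inr true)).map Sum.inl).foldl step s =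
      (s.1, List.replicate k true ++ s.2.1, s.2.2) := by
    intro k
    induction k with
    | zero => intro s; rfl
    | succ k ih =>
      intro s
      rw [List.replicate_succ, List.map_cons, List.foldl_cons, ih, List.replicate_succ']
      simp [step]
  have e₃ : ∀ (b : List Bool) (s), (b.map Sum.inr).foldl step s =
      (s.1, s.2.1, b.reverse ++ s.2.2) := by
    intro b
    induction b with
    | nil => intro s; rfl
    | cons x b ih => intro s; rw [List.map_cons, List.foldl_cons, ih]; simp [step]
  have hf : ∀ s x w, (Sum.elim (fun y => Sum.elim SProg.pushTmp SProg.pushCnt y)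
      SProg.pushLeft x : QProg Unit).Runs (st w [] [] s.1 s.2.1 s.2.2 []) ()
      (st w [] [] (step s x).1 (step s x).2.1 (step s x).2.2 []) 1 := by
    rintro s ((x | x) | x) w
    · exact SProg.runs_pushTmp _ _ _ _ _ _ _ _
    · exact SProg.runs_pushCnt _ _ _ _ _ _ _ _
    · exact SProg.runs_pushLeft _ _ _ _ _ _ _ _
  have h := Prog.runs_foldPop (p := SProg.popInp)
    (f := fun _ x => Sum.elim (fun y => Sum.elim SProg.pushTmp SProg.pushCnt y) SProg.pushLeft x)
    (fun (s : List CSym × List Bool × List Bool) (w : List ((CSym ⊕ Bool) ⊕ Bool)) =>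
      st (B := Bool) w [] [] s.1 s.2.1 s.2.2 []) (fun _ => ()) step (fun _ _ => True) 1
    (fun _ _ _ _ => trivial) (fun s w => SProg.runs_popInp w _ _ _ _ _ _)
    (fun s x w _ => hf s x w) ([], [], []) (queryCode u k b) trivial
  rw [queryCode, List.foldl_append, List.map_append, List.foldl_append, e₁, e₂, e₃] at h
  rw [List.append_nil, List.append_nil, List.append_nil, ← List.map_append] at h
  refine Prog.Runs.mono (m := _) h ?_
  simp
  omega

variable (i : List ((CSym ⊕ Bool) ⊕ Bool)) (o : List Bool) (c t : List CSym) (n l r : List Bool)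

/-- Move the contents of `tmp` to `code`. -/
def restoreCode : QProg Unit := Prog.foldPop SProg.popTmp (fun _ x => SProg.pushCode x) ()

theorem runs_restoreCode : restoreCode.Runs (st i o c t n l r) ()
    (st i o (t.reverse ++ c) [] n l r) (3 * t.length + 2) := by
  rw [← SProg.foldl_cons_eq]
  exact Prog.runs_foldPop (fun s w => st i o s w n l r) (fun _ => ()) (fun s x => x :: s)
    (fun _ _ => True) 1 (fun _ _ _ _ => trivial) (fun s w => SProg.runs_popTmp i o s w n l r)
    (fun s x w _ => SProg.runs_pushCode i o s w n l r x) c t trivial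

/-- Empty the stack `right` and return whether it contained `true`. -/
def scanRight : QProg Bool := Prog.foldPop SProg.popRight (fun b x => Prog.ret (b || x)) false

theorem runs_scanRight : scanRight.Runs (st i o c t n l r) (r.any id) (st i o c t n l [])
    (3 * r.length + 2) := by
  have e : ∀ (r : List Bool) (b : Bool), r.foldl (fun b x => b || x) b = (b || r.any id) := by
    intro r
    induction r with
    | nil => intro b; simp
    | cons x r ih => intro b; rw [List.foldl_cons, ih, List.any_cons, id, Bool.or_assoc]
  have h := Prog.runs_foldPop (p := SProg.popRight) (f := fun b x => Prog.ret (b || x))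
    (fun (_ : Bool) w => st i o c t n l w) id (fun b x => b || x)
    (fun _ _ => True) 1 (fun _ _ _ _ => trivial) (fun s w => SProg.runs_popRight i o c t n l w)
    (fun s x w _ => Prog.runs_ret (s || x)) false r trivial
  rw [e, Bool.false_or] at h
  exact h

/-- Empty the stack `cnt`. -/
def clearCnt : QProg Unit := Prog.foldPop SProg.popCnt (fun _ _ => Prog.ret ()) ()

theorem runs_clearCnt : clearCnt.Runs (st i o c t n l r) () (st i o c t [] l r)
    (3 * n.length + 2) :=
  Prog.runs_foldPop (τ := Unit) (fun _ w => st i o c t w l r) (fun _ => ()) (fun _ _ => ())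
    (fun _ _ => True) 1 (fun _ _ _ _ => trivial) (fun _ w => SProg.runs_popCnt i o c t w l r)
    (fun _ _ _ _ => Prog.runs_ret ()) () n trivial

/-- Remove as many bits from `right` as there are symbols on `tmp`, and remove these, too. -/
def skipTmp : QProg Unit :=
  Prog.foldPop SProg.popTmp (fun _ _ => SProg.popRight.bind fun _ => Prog.ret ()) ()

theorem runs_skipTmp : skipTmp.Runs (st i o c t n l r) () (st i o c [] n l (r.drop t.length))
    (4 * t.length + 2) := by
  have e : ∀ (t : List CSym) (r : List Bool), t.foldl (fun r _ => r.tail) r = r.drop t.length := by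
    intro t
    induction t with
    | nil => intro r; rfl
    | cons x t ih => intro r; rw [List.foldl_cons, ih, List.drop_tail, List.length_cons]
  rw [← e]
  exact Prog.runs_foldPop (fun s w => st i o c w n l s) (fun _ => ()) (fun r _ => r.tail)
    (fun _ _ => True) 2 (fun _ _ _ _ => trivial) (fun s w => SProg.runs_popTmp i o c w n l s)
    (fun s _ w _ => Prog.Runs.bind (f := fun _ => Prog.ret ()) (SProg.runs_popRight i o c w n l s)
      (Prog.runs_ret ())) r t trivial

/-- Copy a number from the beginning of the code to `tmp`. -/
def readOut : QProg Unit := readNat (fun _ => SProg.pushTmp .tick) ()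

theorem runs_readOut (m : ℕ) : readOut.Runs (st i o (codeNat m ++ c) [] n l r) ()
    (st i o c (List.replicate m .tick) n l r) (3 * m + 2) := by
  have e : ∀ m : ℕ, (fun t => CSym.tick :: t)^[m] [] = List.replicate m .tick := by
    intro m
    induction m with
    | zero => rfl
    | succ m ih => rw [Function.iterate_succ_apply', ih, List.replicate_succ]
  rw [← e]
  exact runs_readNat (fun s w => st i o w s n l r) (fun _ => ()) (fun t => CSym.tick :: t) 1
    (fun s w => SProg.runs_popCode i o w s n l r)
    (fun s w => SProg.runs_pushTmp i o w s n l r .tick) [] m c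

theorem runs_countVars (k : ℕ) (a : List Bool) :
    (readNat countVar 0).Runs (st i o (codeNat a.length ++ c) t (List.replicate k true) [] (a ++ r))
      (sat (a.count true - k))
      (st i o c t (List.replicate (k - a.count true) true) a.reverse r) (6 * a.length + 2) := by
  have h := runs_readNat
    (fun (s : Fin 3 × List Bool × List Bool × List Bool) w => st i o w t s.2.1 s.2.2.1 s.2.2.2)
    (fun s => s.1) countVarNext 4 (fun s w => SProg.runs_popCode i o w t _ _ _)
    (fun s w => runs_countVar i o w t s.2.1 s.2.2.1 s.2.2.2 s.1)
    (sat (0 - k), List.replicate (k - 0) true, [], a ++ r) a.length c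
  rw [countVarNext_iterate, Nat.zero_add, List.append_nil] at h
  rw [Nat.zero_sub] at h
  exact h

/-- The common program of the two oracles. It answers a query `(C, k), X` by
`ψ d top loop more val`, where `d` is `min 2` of the excess of the number of variables in `X` over
`k`, `top` and `loop` tell whether the top element and whether some loop is in `X`, `more` tells
whether `k` exceeds the number of variables in `X`, and `val` is the value of `C`. -/
def oracleProg (ψ : Fin 3 → Bool → Bool → Bool → Bool → Bool) : QProg Unit :=
  splitQuery.seq <| restoreCode.seq <| SProg.rewind.seq <|
  (readNat countVar 0).bind fun d =>
  SProg.popRight.bind fun top =>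
  scanRight.bind fun loop => SProg.rewind.seq <| readOut.seq <| evalGates.seq <| skipTmp.seq <|
  SProg.popRight.bind fun val =>
  scanRight.bind fun _ =>
  SProg.popCnt.bind fun more => clearCnt.seq <|
  SProg.pushOut (ψ d (top.getD false) loop more.isSome (val.getD false))

end

/-- The oracle program on a query whose bits are the values `a` of the variables, the bit `x` of the
top element and the bits `r` of the loops. -/
theorem runs_oracleProg (ψ : Fin 3 → Bool → Bool → Bool → Bool → Bool) (C : Circuit) (k : ℕ)
    (a : List Bool) (x : Bool) (r : List Bool) (ha : a.length = C.n) {N : ℕ}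
    (hN : C.code.length + k ≤ N) (hb : a.length + 1 + r.length ≤ N) :
    (oracleProg ψ).Runs (st (queryCode C.code k (a ++ x :: r)) [] [] [] [] [] []) ()
      (st [] [ψ (sat (a.count true - k)) x (r.any id) (decide (a.count true < k))
        ((C.gates.foldl (fun v g => v ++ [g.eval v]) a).getD C.out false)] [] [] [] [] [])
      (6 * N ^ 2 + 100 * N + 100) := by
  have hcode : C.code = codeNat a.length ++ (codeNat C.out ++ C.gates.flatMap Gate.code) := by
    rw [ha, Circuit.code, List.append_assoc]
  have hlen : ∀ m, (codeNat m).length = m + 1 := by simp [codeNat]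
  have hcode' := congrArg List.length hcode
  rw [List.length_append, List.length_append, hlen, hlen] at hcode'
  have hwlen := length_foldl_gates_le C.gates a
  have h₁ := runs_splitQuery C.code k (a ++ x :: r)
  have h₂ := runs_restoreCode [] [] [] C.code.reverse (List.replicate k true)
    (a ++ x :: r).reverse []
  rw [List.reverse_reverse, List.append_nil] at h₂
  have h₃ := SProg.runs_rewind (A := (CSym ⊕ Bool) ⊕ Bool) (B := Bool) [] []
    C.code [] (List.replicate k true) (a ++ x :: r).reverse []
  rw [List.reverse_reverse, List.append_nil] at h₃
  have h₄ := runs_countVars [] [] (codeNat C.out ++ C.gates.flatMap Gate.code) [] (x :: r) k a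
  rw [← hcode] at h₄
  generalize hgc : C.gates.flatMap Gate.code = gc at *
  set more := List.replicate (k - a.count true) true with hmore
  have h₅ := SProg.runs_popRight (A := (CSym ⊕ Bool) ⊕ Bool) (B := Bool) [] []
    (codeNat C.out ++ gc) [] more a.reverse (x :: r)
  have h₆ := runs_scanRight [] [] (codeNat C.out ++ gc) [] more a.reverse r
  have h₇ := SProg.runs_rewind (A := (CSym ⊕ Bool) ⊕ Bool) (B := Bool) [] []
    (codeNat C.out ++ gc) [] more a.reverse []
  rw [List.reverse_reverse, List.append_nil] at h₇
  have h₈ := runs_readOut [] [] gc more [] a C.out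
  have h₉ := runs_evalGates [] [] (List.replicate C.out .tick) more C.gates a (W := N)
    (by rw [hgc]; omega)
  rw [hgc] at h₉
  generalize hw : C.gates.foldl (fun v g => v ++ [g.eval v]) a = w at *
  have h₁₀ := runs_skipTmp [] [] [] (List.replicate C.out .tick) more [] w
  rw [List.length_replicate] at h₁₀
  have h₁₁ := SProg.runs_popRight (A := (CSym ⊕ Bool) ⊕ Bool) (B := Bool) [] [] [] [] more []
    (w.drop C.out)
  have h₁₂ := runs_scanRight [] [] [] [] more [] (w.drop C.out).tail
  have h₁₃ := SProg.runs_popCnt (A := (CSym ⊕ Bool) ⊕ Bool) (B := Bool) [] [] [] [] more [] []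
  have h₁₄ := runs_clearCnt [] [] [] [] more.tail [] []
  have e₁ : w.getD C.out false = (w.drop C.out).head?.getD false := by
    rw [List.head?_drop, List.getD_eq_getElem?_getD]
  have e₂ : decide (a.count true < k) = more.head?.isSome := by
    rw [hmore]
    rcases Nat.lt_or_ge (a.count true) k with h | h
    · obtain ⟨m, hm⟩ := Nat.exists_eq_add_of_lt h
      have : k - a.count true = m + 1 := by omega
      rw [this, List.replicate_succ]
      simpa using h
    · rw [Nat.sub_eq_zero_of_le h]
      simpa using h
  rw [e₁, e₂]
  have h₁₅ := SProg.runs_pushOut (A := (CSym ⊕ Bool) ⊕ Bool) [] [] [] [] [] [] []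
    (ψ (sat (a.count true - k)) x (r.any id) more.head?.isSome ((w.drop C.out).head?.getD false))
  have hm : more.length ≤ k := by simp [hmore]
  apply Prog.Runs.mono
  · unfold oracleProg
    apply Prog.Runs.seq h₁
    apply Prog.Runs.seq h₂
    apply Prog.Runs.seq h₃
    apply Prog.Runs.bind h₄
    apply Prog.Runs.bind h₅
    apply Prog.Runs.bind h₆
    apply Prog.Runs.seq h₇
    apply Prog.Runs.seq h₈
    apply Prog.Runs.seq h₉
    apply Prog.Runs.seq h₁₀
    apply Prog.Runs.bind h₁₁
    apply Prog.Runs.bind h₁₂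
    apply Prog.Runs.bind h₁₃
    apply Prog.Runs.seq h₁₄
    exact h₁₅
  -- Only the evaluation of the gates takes more than linear time.
  · simp only [List.length_append, List.length_cons, List.length_reverse, List.length_tail,
      List.length_drop]
    have hgc' : (6 * N + 8) * gc.length ≤ (6 * N + 8) * N := Nat.mul_le_mul_left _ (by omega)
    have e : (6 * N + 8) * N = 6 * N ^ 2 + 8 * N := by ring
    omega

/-! ### The oracles of the two families -/

theorem sat_eq_zero_iff (m : ℕ) : sat m = 0 ↔ m = 0 := by
  match m with
  | 0 => simp [sat]
  | 1 => simp [sat]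
  | m + 2 => simp [sat]

theorem sat_eq_two_iff (m : ℕ) : sat m = 2 ↔ 2 ≤ m := by
  match m with
  | 0 => simp [sat]
  | 1 => simp [sat]
  | m + 2 => simp [sat]

theorem count_true_ofFn {n : ℕ} (a : Fin n → Bool) :
    (List.ofFn a).count true = (Finset.univ.filter fun i => a i = true).card := by
  induction n with
  | zero => simp
  | succ n ih =>
    rw [List.ofFn_succ, List.count_cons, ih, Fin.card_filter_univ_succ']
    simp [add_comm]

/-- The indicator function of a set lists the values of the variables, then the top element, then
the loops. -/
theorem exists_ofFn_eq (h : Circuit × ℕ) (X : Finset (Fin (circuitDomain.size h))) :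
    ∃ r : List Bool, (List.ofFn fun i => decide (i ∈ X)) =
      List.ofFn (assignment h X) ++ decide (topElt h ∈ X) :: r ∧
      (r.any id = true ↔ ∃ i ∈ X, h.1.n < i) := by
  have hn := n_lt_size h
  refine ⟨(List.ofFn fun i => decide (i ∈ X)).drop (h.1.n + 1), ?_, ?_⟩
  · have e : (List.ofFn fun i => decide (i ∈ X)).take h.1.n = List.ofFn (assignment h X) := by
      refine List.ext_getElem (by simp [hn.le]) fun i hi hi' => ?_
      rw [List.getElem_take, List.getElem_ofFn, List.getElem_ofFn]
      rfl
    have e' : (List.ofFn fun i => decide (i ∈ X))[h.1.n]'(by simpa using hn) =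
        decide (topElt h ∈ X) := List.getElem_ofFn _
    rw [← e, ← e', ← List.drop_eq_getElem_cons, List.take_append_drop]
  · rw [List.any_eq_true]
    constructor
    · rintro ⟨b, hb, hb'⟩
      obtain ⟨i, hi, rfl⟩ := List.mem_drop_iff_getElem.1 hb
      rw [List.getElem_ofFn] at hb'
      exact ⟨_, by simpa using hb', by simp; omega⟩
    · rintro ⟨i, hi, hlt⟩
      refine ⟨true, List.mem_drop_iff_getElem.2 ⟨i - (h.1.n + 1), ?_, ?_⟩, rfl⟩
      · simp; omega
      · rw [List.getElem_ofFn]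
        have : h.1.n + 1 + (i - (h.1.n + 1)) = (i : ℕ) := by omega
        simp [this, hi]

/-- A family is given by a uniform polynomial-time oracle if membership of `X` is a Boolean function
of the excess of the number of variables in `X` over `k`, of the presence of the top element and of
loops, and of the value of the circuit. -/
theorem hasUniformPolyTimeOracle_of_iff {F : circuitDomain.SetSystem}
    (ψ : Fin 3 → Bool → Bool → Bool → Bool → Bool)
    (hF : ∀ (h : Circuit × ℕ) (X : Finset (Fin (circuitDomain.size h))), X ∈ F h ↔
      ψ (sat ((varSet h X).card - h.2)) (decide (topElt h ∈ X)) (decide (∃ i ∈ X, h.1.n < i))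
        (decide ((varSet h X).card < h.2)) (h.1.eval (assignment h X)) = true) :
    HasUniformPolyTimeOracle circuitDomain F := by
  refine ⟨6 * Polynomial.X ^ 2 + 100 * Polynomial.X + 101, ?_⟩
  refine ComputableWithin.mono (ComputableWithin.of_sprog (oracleProg ψ)
    (t := fun q => 6 * (circuitDomain.size q.1) ^ 2 + 100 * circuitDomain.size q.1 + 100)
    fun q => ?_) fun q => le_of_eq (by simp)
  obtain ⟨h, X⟩ := q
  change Circuit × ℕ at h
  obtain ⟨r, hr, hr'⟩ := exists_ofFn_eq h X
  have hlen := congrArg List.length hr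
  rw [List.length_ofFn, List.length_append, List.length_ofFn, List.length_cons] at hlen
  have hrun := runs_oracleProg ψ h.1 h.2 (List.ofFn (assignment h X)) (decide (topElt h ∈ X)) r
    List.length_ofFn (size_eq h).ge (by rw [List.length_ofFn]; omega)
  have e₁ : circuitDomain.encQuery ⟨h, X⟩ = queryCode h.1.code h.2
      (List.ofFn (assignment h X) ++ decide (topElt h ∈ X) :: r) := by
    rw [← hr, queryCode]
    exact congrArg (fun w => List.map Sum.inl w ++ List.map Sum.inr _) (circuitDomain_encode h)
  have e₂ : r.any id = decide (∃ i ∈ X, h.1.n < i) := by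
    rw [Bool.eq_iff_iff, hr', decide_eq_true_iff]
  rw [count_true_ofFn, e₂, ← e₁] at hrun
  have e₃ : ∀ inst : Decidable (X ∈ F h), @decide (X ∈ F h) inst = _ := fun inst =>
    Bool.eq_iff_iff.2 (decide_eq_true_iff.trans (hF h X))
  dsimp only
  rw [e₃]
  exact hrun

theorem hasUniformPolyTimeOracle_weightMatroid :
    HasUniformPolyTimeOracle circuitDomain weightMatroid := by
  refine hasUniformPolyTimeOracle_of_iff (fun d _ loop _ _ => !loop && decide (d = 0))
    fun h X => ?_
  simp only [weightMatroid, Set.mem_ofPred_eq, Bool.and_eq_true, Bool.not_eq_true',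
    decide_eq_true_iff, decide_eq_false_iff_not, sat_eq_zero_iff, not_exists, not_and, not_lt,
    Nat.sub_eq_zero_iff_le]

theorem hasUniformPolyTimeOracle_satGreedoid :
    HasUniformPolyTimeOracle circuitDomain satGreedoid := by
  refine hasUniformPolyTimeOracle_of_iff (fun d top loop more val =>
    !loop && if top then (decide (d = 0) && !more) && val else decide (d ≠ 2)) fun h X => ?_
  simp only [satGreedoid, Set.mem_ofPred_eq, Bool.and_eq_true, Bool.not_eq_true',
    decide_eq_true_iff, decide_eq_false_iff_not, not_exists, not_and, not_lt]
  refine and_congr_right fun _ => ?_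
  split_ifs with ht
  · rw [Bool.and_eq_true, Bool.and_eq_true, decide_eq_true_iff, sat_eq_zero_iff,
      Bool.not_eq_true', decide_eq_false_iff_not]
    refine and_congr_left fun _ => ?_
    omega
  · rw [decide_eq_true_iff, ne_eq, sat_eq_two_iff]
    omega

end MGI

/-- There are a matroid family and a greedoid family over the same, efficiently computable domains,
given by uniform polynomial-time oracles, whose parameterized intersection problem is W[P]-hard;
moreover, weighted circuit satisfiability reduces to it with the parameter map `k ↦ k + 1`. -/
theorem theoremt :
    ∃ (D : MGI.DomainFamily) (F G : D.SetSystem),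
      D.IsPolyTime ∧
      (∀ h, MGI.IsMatroid (F h)) ∧
      (∀ h, MGI.IsGreedoid (G h)) ∧
      MGI.HasUniformPolyTimeOracle D F ∧
      MGI.HasUniformPolyTimeOracle D G ∧
      MGI.WPHard (MGI.intersectionProblem D F G) ∧
      MGI.ReducesVia MGI.weightedCircuitSat (MGI.intersectionProblem D F G)
        (fun k => k + 1) := by
  exact ⟨MGI.circuitDomain, MGI.weightMatroid, MGI.satGreedoid, MGI.isPolyTime_circuitDomain,
    MGI.isMatroid_weightMatroid, MGI.isGreedoid_satGreedoid,
    MGI.hasUniformPolyTimeOracle_weightMatroid, MGI.hasUniformPolyTimeOracle_satGreedoid,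
    fun _ ⟨_, hf⟩ => ⟨_, hf.trans MGI.reducesVia_intersectionProblem⟩,
    MGI.reducesVia_intersectionProblem⟩
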